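/- Let $k\ge 1$ and let $(W(\mathbf t):\mathbf t\in\mathbb R^k)$ be a real-valued zero-mean Gaussian random field with stationary increments; write $\sigma^2(\mathbf t)$ for the variance of $W(\mathbf t)$ and $\gamma(\mathbf t)=\mathbb E(W(\mathbf t)-W(\mathbf 0))^2$ for its variogram, so that $\mathbb E(W(\mathbf t)-W(\mathbf s))^2=\gamma(\mathbf t-\mathbf s)$ for all $\mathbf s,\mathbf t\in\mathbb R^k$. Let $(U_i)_{i\ge1}$ be the points of a Poisson point process $\sum_i\delta_{U_i}$ on $(0,\infty)$ with intensity $du/u^2$, let $W_1,W_2,\dots$ be i.i.d. copies of the random field $W$, independent of $(U_i)_{i\ge 1}$, and let $$X(\mathbf t)=\max_{i\ge1}\,U_i\exp\{W_i(\mathbf t)-\sigma^2(\mathbf t)/2\},\qquad \mathbf t\in\mathbb Z^k,$$ be the associated Brown–Resnick random field on $\mathbb Z^k$. A random vector $\mathbf Z$ in $\mathbb R^n$ is called regularly varying with exponent $\alpha>0$ if there are a function $V$, regularly varying at infinity with index $-\alpha$, and a nonzero Radon measure $\mu$ on $[-\infty,\infty]^n\setminus\{\mathbf 0\}$, not charging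 points with an infinite coordinate, such that $\mathbb P(x^{-1}\mathbf Z\in\cdot)/V(x)\to\mu$ vaguely as $x\to\infty$. The tail field of $X$ is the random field $(Y(\mathbf t):\mathbf t\in\mathbb Z^k)$ which is the limit, in the sense of weak convergence of finite-dimensional distributions, of the conditional laws of $(x^{-1}X(\mathbf t):\mathbf t\in\mathbb Z^k)$ given $|X(\mathbf 0)|>x$, as $x\to\infty$. Then $X$ is jointly regularly varying with exponent $\alpha=1$, that is, $(X(\mathbf t_1),\dots,X(\mathbf t_n))$ is regularly varying with exponent $1$ for all $n\ge1$ and $\mathbf t_1,\dots,\mathbf t_n\in\mathbb Z^k$. Its tail field $Y$ exists, and for all $n\ge1$, $\mathbf t_1,\dots,\mathbf t_n\in\mathbb Z^k$ and $y_1,\dots,y_n>0$, $$\mathbb P(Y(\mathbf t_1)\le y_1,\dots,Y(\mathbf t_n)\le y_n)=\mathbb E\Big[\max\Big(\max_{1\le i\le n}\tfrac1{y_i}e^{W(\mathbf t_i)-\sigma^2(\mathbf t_i)/2},\;e^{W(\mathbf 0)-\sigma^2(\mathbf 0)/2}\Big)\Big]-\mathbb E\Big[\max_{1\le i\le n}\tfrac1{y_i}e^{W(\mathbf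 t_i)-\sigma^2(\mathbf t_i)/2}\Big],$$ where both expectations are finite. In particular, for all $y>0$ and $\mathbf t\in\mathbb Z^k$ with $\gamma(\mathbf t)>0$, $$\mathbb P(Y(\mathbf t)\le y)=\Phi\Big(\frac{2\ln y+\gamma(\mathbf t)}{2\sqrt{\gamma(\mathbf t)}}\Big)-\frac1y\,\Phi\Big(\frac{2\ln y-\gamma(\mathbf t)}{2\sqrt{\gamma(\mathbf t)}}\Big),$$ where $\Phi$ is the standard normal distribution function, while for $\mathbf t\in\mathbb Z^k$ with $\gamma(\mathbf t)=0$ (for instance $\mathbf t=\mathbf 0$) the limiting form of this formula holds: $\mathbb P(Y(\mathbf t)\le y)=\max(0,1-1/y)$ for all $y>0$. -/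

import Mathlib

open MeasureTheory ProbabilityTheory Filter Topology
open scoped ENNReal NNReal BoundedContinuousFunction

noncomputable section

/-! ### Regular variation -/

/-- `V` is a (measurable, positive on `(0, ∞)`) regularly varying function at infinity with
index `ρ`. -/
def IsRegularlyVaryingFunction (V : ℝ → ℝ) (ρ : ℝ) : Prop :=
  Measurable V ∧ (∀ x, 0 < x → 0 < V x) ∧
    ∀ u : ℝ, 0 < u → Tendsto (fun x => V (u * x) / V x) atTop (𝓝 (u ^ ρ))

/-- The space `[-∞, ∞]^ι \ {0}`, with the subspace topology and its Borel σ-algebra. -/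
abbrev PuncturedExtended (ι : Type*) : Type _ := {z : ι → EReal // z ≠ 0}

/-- The measure `ℙ(x⁻¹ X ∈ ·)` on `[-∞, ∞]^ι \ {0}`. -/
def scaledLaw {ι Ω : Type*} [MeasurableSpace Ω] (P : Measure Ω) (X : ι → Ω → ℝ) (x : ℝ) :
    Measure (PuncturedExtended ι) :=
  (P.map (fun ω (i : ι) => ((x⁻¹ * X i ω : ℝ) : EReal))).comap Subtype.val

/-- The random vector `X = (X i)_{i ∈ ι}` is multivariate regularly varying with exponent `α`:
there are a normalizing function `V`, regularly varying with index `-α`, and a nonzero Radon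
measure `μ` on `[-∞, ∞]^ι \ {0}` without mass at infinite points such that
`ℙ(x⁻¹ X ∈ ·) / V x → μ` vaguely as `x → ∞`. -/
def IsRegularlyVaryingVector {ι Ω : Type*} [MeasurableSpace Ω] (P : Measure Ω)
    (X : ι → Ω → ℝ) (α : ℝ) : Prop :=
  0 < α ∧ ∃ (V : ℝ → ℝ) (μ : Measure (PuncturedExtended ι)),
    IsRegularlyVaryingFunction V (-α) ∧ μ.Regular ∧ μ ≠ 0 ∧
    μ {z | ∃ i, z.1 i = ⊤ ∨ z.1 i = ⊥} = 0 ∧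
    ∀ f : PuncturedExtended ι → ℝ, Continuous f → HasCompactSupport f →
      Tendsto (fun x : ℝ => (∫ z, f z ∂(scaledLaw P X x)) / V x) atTop (𝓝 (∫ z, f z ∂μ))

/-- The real random field `X` is jointly regularly varying with index `α`: every random vector
`(X(t₁), …, X(tₙ))`, `n ≥ 1`, is multivariate regularly varying with exponent `α`. -/
def IsJointlyRegularlyVarying {T Ω : Type*} [MeasurableSpace Ω] (P : Measure Ω)
    (X : T → Ω → ℝ) (α : ℝ) : Prop :=
  ∀ (n : ℕ), 0 < n → ∀ t : Fin n → T, IsRegularlyVaryingVector P (fun i => X (t i)) α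

/-! ### The tail field -/

/-- The random field `Y` on `(Ω', Q)` is the tail field of the random field `X` on `(Ω, P)`: as
`x → ∞`, the finite-dimensional distributions of `x⁻¹ X` conditionally on `|X(0)| > x` converge
weakly to those of `Y`. -/
def IsTailField {T Ω Ω' : Type*} [Zero T] [MeasurableSpace Ω] [MeasurableSpace Ω']
    (P : Measure Ω) (X : T → Ω → ℝ) (Q : Measure Ω') (Y : T → Ω' → ℝ) : Prop :=
  IsProbabilityMeasure Q ∧ (∀ t, Measurable (Y t)) ∧
    ∀ (n : ℕ) (t : Fin n → T) (f : (Fin n → ℝ) →ᵇ ℝ),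
      Tendsto
        (fun x : ℝ => ∫ ω, f (fun i => x⁻¹ * X (t i) ω) ∂(P[|{ω | x < |X 0 ω|}]))
        atTop (𝓝 (∫ ω, f (fun i => Y (t i) ω) ∂Q))

/-! ### Brown-Resnick random fields -/

/-- The random points `U 0, U 1, …` form a Poisson point process `∑ᵢ δ_{U i}` on `E` with
intensity `ν`: the number of points in a measurable set of finite intensity has a Poisson
distribution, and the numbers of points in disjoint measurable sets are independent. -/
structure IsPoissonPointProcess {E Ω : Type*} [MeasurableSpace E] [MeasurableSpace Ω]
    (P : Measure Ω) (U : ℕ → Ω → E) (ν : Measure E) : Prop where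
  measurable : ∀ i, Measurable (U i)
  hasLaw_count : ∀ B : Set E, MeasurableSet B → ν B ≠ ∞ →
    HasLaw (fun ω => Measure.sum (fun i => Measure.dirac (U i ω)) B)
      ((poissonMeasure (ν B).toNNReal).map (fun n : ℕ => (n : ℝ≥0∞))) P
  indep_count : ∀ (n : ℕ) (B : Fin n → Set E), (∀ j, MeasurableSet (B j)) →
    Pairwise (fun i j => Disjoint (B i) (B j)) →
    iIndepFun (fun j ω => Measure.sum (fun i => Measure.dirac (U i ω)) (B j)) P

/-- The measure `du / u²` on `(0, ∞)`, as a measure on `ℝ` that does not charge `(-∞, 0]`. -/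
def inverseSquareIntensity : Measure ℝ :=
  (volume.restrict (Set.Ioi (0 : ℝ))).withDensity (fun u => ENNReal.ofReal (1 / u ^ 2))

/-- The variogram `γ(t) = 𝔼 (W(t) - W(0))²`. -/
def variogram {T Ω : Type*} [Zero T] [MeasurableSpace Ω] (P : Measure Ω) (W : T → Ω → ℝ)
    (t : T) : ℝ :=
  ∫ ω, (W t ω - W 0 ω) ^ 2 ∂P

/-- `W` is a zero-mean Gaussian random field on `ℝ^k` with stationary increments. -/
structure IsStationaryIncrementGaussianField {k : ℕ} {Ω : Type*} [MeasurableSpace Ω]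
    (P : Measure Ω) (W : (Fin k → ℝ) → Ω → ℝ) : Prop where
  measurable : ∀ t, Measurable (W t)
  gaussian : IsGaussianProcess W P
  mean_zero : ∀ t, ∫ ω, W t ω ∂P = 0
  stationary_increments : ∀ s t, ∫ ω, (W t ω - W s ω) ^ 2 ∂P = variogram P W (t - s)

/-- `exp (W(t) - σ²(t) / 2)` where `σ²(t)` is the variance of `W(t)`. -/
def expGaussian {T Ω : Type*} [MeasurableSpace Ω] (P : Measure Ω) (W : T → Ω → ℝ)
    (t : T) (ω : Ω) : ℝ :=
  Real.exp (W t ω - Var[W t; P] / 2)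

/-- The Brown-Resnick random field `X(t) = maxᵢ Uᵢ exp (Wᵢ(t) - σ²(t) / 2)`, where `σ²(t)` is the
variance of `W(t)`. -/
def brownResnickField {T Ω₀ Ω : Type*} [MeasurableSpace Ω₀] (P₀ : Measure Ω₀)
    (W : T → Ω₀ → ℝ) (U : ℕ → Ω → ℝ) (Wc : ℕ → T → Ω → ℝ) (t : T) (ω : Ω) : ℝ :=
  ⨆ i : ℕ, U i ω * Real.exp (Wc i t ω - Var[W t; P₀] / 2)

/-- The point of the integer grid `ℤ^k`, as a point of `ℝ^k`. -/
def gridPoint {k : ℕ} (t : Fin k → ℤ) : Fin k → ℝ := fun j => (t j : ℝ)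

/-- The standard normal cumulative distribution function. -/
def stdNormalCDF (x : ℝ) : ℝ := cdf (gaussianReal 0 1) x

end

/-! ### Poisson point processes -/

/-! Write `η t = exp (W t - σ² t / 2)`, a positive field with mean-one margins, let `m = du/u² ⊗
P₀`, and let `Z t (u, ω) = u * η t ω`. Everything is read off from `m`. The points `(U i, W i)`
behave like a Poisson process with intensity `m`, so the probability that no `U i * η_i (t j)`
exceeds `y j` is `exp (-v)`, where `v = m {∃ j, y j < Z (t j)} = 𝔼 max_j η (t j) / y j`. This void
probability follows from the generating functional `IsPoissonPointProcess.lintegral_tprod_one_sub`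
after integrating out the marks.

Since `m` is homogeneous of order `-1` along `Z`, the probability that `X (t j) > x * y j` for some
`j` is `1 - exp (-v / x)`, and `x` times it tends to `v`. Differences of such limits give
convergence of distribution functions, hence weak convergence of `x P(X / x ∈ ·)` to the law of `Z`
under `m`, on any region where some coordinate from a set `J` exceeds `δ > 0`
(`tendsto_mul_setIntegral`). Taking all coordinates for `J` gives regular variation with `V x = 1 /
x`. Taking the origin alone, with `δ = 1`, gives the tail field: its law is that of `Z` under `m`
restricted to `{Z 0 > 1}`, a set of mass `𝔼 η 0 = 1`. Its distribution function `m {Z 0 > 1, Z (t i)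
≤ y i}` is the difference of two exceedance masses, that is, of two expectations.

For a single point the difference is an integral of exponentials of Gaussians over `{W t - W 0 ≤
a}`. Exponential tilting by `W 0` or `W t` only shifts the mean of the increment
(`map_tilted_eq_gaussianReal`), which yields the two normal terms. -/

lemma lintegral_rpow_map_cast_poissonMeasure (r : ℝ≥0) {c : ℝ≥0∞} (hc : c ≤ 1) :
    ∫⁻ x, c ^ x.toReal ∂((poissonMeasure r).map (fun n : ℕ => (n : ℝ≥0∞)))
      = ENNReal.ofReal (Real.exp (-(r * (1 - c.toReal)))) := by
  rw [lintegral_map (by fun_prop) .of_discrete]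
  simp only [ENNReal.toReal_natCast, ENNReal.rpow_natCast]
  have hc' : ENNReal.ofReal c.toReal = c :=
    ENNReal.ofReal_toReal (ne_top_of_le_ne_top ENNReal.one_ne_top hc)
  rw [poissonMeasure, lintegral_sum_measure]
  simp only [lintegral_smul_measure, lintegral_dirac, smul_eq_mul]
  have hs : HasSum (fun n : ℕ => Real.exp (-r) * r ^ n / (n.factorial : ℝ) * c.toReal ^ n)
      (Real.exp (-(r * (1 - c.toReal)))) := by
    convert! (NormedSpace.expSeries_div_hasSum_exp ((r : ℝ) * c.toReal)).mul_left
      (Real.exp (-r)) using 1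
    · ext n
      rw [mul_pow]
      ring
    · rw [← Real.exp_eq_exp_ℝ, ← Real.exp_add]
      ring_nf
  rw [← hs.tsum_eq, ENNReal.ofReal_tsum_of_nonneg (fun n => by positivity) hs.summable]
  refine tsum_congr fun n => ?_
  rw [ENNReal.ofReal_mul (by positivity), ENNReal.ofReal_pow ENNReal.toReal_nonneg, hc']

lemma sum_dirac_apply_eq_encard {E Ω : Type*} [MeasurableSpace E] (U : ℕ → Ω → E) {B : Set E}
    (hB : MeasurableSet B) (ω : Ω) :
    Measure.sum (fun i => Measure.dirac (U i ω)) B = ({i | U i ω ∈ B}.encard : ℝ≥0∞) := by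
  rw [Measure.sum_apply _ hB, ← ENNReal.tsum_set_one,
    tsum_subtype {i | U i ω ∈ B} (fun _ => (1 : ℝ≥0∞))]
  refine tsum_congr fun i => ?_
  rw [Measure.dirac_apply' _ hB]
  rfl

lemma measurable_sum_dirac_apply {E Ω : Type*} [MeasurableSpace E] [MeasurableSpace Ω]
    {U : ℕ → Ω → E} (hU : ∀ i, Measurable (U i)) {B : Set E} (hB : MeasurableSet B) :
    Measurable (fun ω => Measure.sum (fun i => Measure.dirac (U i ω)) B) := by
  simp_rw [Measure.sum_apply _ hB, Measure.dirac_apply' _ hB]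
  exact Measurable.tsum fun i => (measurable_one.indicator hB).comp (hU i)

lemma IsPoissonPointProcess.ae_count_lt_top {E Ω : Type*} [MeasurableSpace E] [MeasurableSpace Ω]
    {P : Measure Ω} {U : ℕ → Ω → E} {ν : Measure E} (hU : IsPoissonPointProcess P U ν)
    {B : Set E} (hB : MeasurableSet B) (hνB : ν B ≠ ∞) :
    ∀ᵐ ω ∂P, Measure.sum (fun i => Measure.dirac (U i ω)) B ≠ ∞ := by
  have h := hU.hasLaw_count B hB hνB
  refine ae_of_ae_map h.aemeasurable (p := fun x => x ≠ ∞) ?_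
  rw [h.map_eq]
  exact (ae_map_iff .of_discrete (MeasurableSet.singleton (∞ : ℝ≥0∞)).compl).2
    (ae_of_all _ fun n => by simp)

/-- A Poisson count with mean zero vanishes almost surely. Applied to `(-∞, 0]`, this makes all
points of the process positive. -/
lemma IsPoissonPointProcess.ae_notMem {E Ω : Type*} [MeasurableSpace E] [MeasurableSpace Ω]
    {P : Measure Ω} {U : ℕ → Ω → E} {ν : Measure E} (hU : IsPoissonPointProcess P U ν)
    {B : Set E} (hB : MeasurableSet B) (hνB : ν B = 0) :
    ∀ᵐ ω ∂P, ∀ i, U i ω ∉ B := by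
  have h := hU.hasLaw_count B hB (by simp [hνB])
  have h0 : ∀ᵐ ω ∂P, Measure.sum (fun i => Measure.dirac (U i ω)) B = 0 := by
    refine ae_of_ae_map h.aemeasurable (p := fun x => x = 0) ?_
    rw [h.map_eq]
    refine (ae_map_iff .of_discrete (MeasurableSet.singleton (0 : ℝ≥0∞))).2 ?_
    rw [poissonMeasure, Measure.ae_sum_iff]
    intro n
    rcases Nat.eq_zero_or_pos n with rfl | hn
    · refine Measure.ae_smul_measure ?_ _
      rw [ae_dirac_eq]
      exact Nat.cast_zero
    · simp [hνB, hn.ne']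
  filter_upwards [h0] with ω hω i hi
  rw [sum_dirac_apply_eq_encard U hB] at hω
  simp only [ENat.toENNReal_eq_zero, Set.encard_eq_zero] at hω
  exact (Set.eq_empty_iff_forall_notMem.1 hω) i hi

/-- The factors are grouped by the value of `s`. The value `0` is left out: its fibre may contain
infinitely many points, but they contribute factors `1`. -/
lemma tprod_one_sub_simpleFunc {E Ω : Type*} [MeasurableSpace E]
    (U : ℕ → Ω → E) (s : SimpleFunc E ℝ≥0∞) (ω : Ω)
    (hω : ∀ c ∈ s.range.filter (· ≠ 0),
      Measure.sum (fun i => Measure.dirac (U i ω)) (s ⁻¹' {c}) ≠ ∞) :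
    ∏' i, (1 - s (U i ω)) = ∏ c ∈ s.range.filter (· ≠ 0),
      (1 - c) ^ (Measure.sum (fun i => Measure.dirac (U i ω)) (s ⁻¹' {c})).toReal := by
  classical
  have hfib : ∀ c ∈ s.range.filter (· ≠ 0), {i | s (U i ω) = c}.Finite := by
    intro c hc
    have := hω c hc
    rw [sum_dirac_apply_eq_encard U (s.measurableSet_fiber c)] at this
    rw [ne_eq, ENat.toENNReal_eq_top] at this
    exact Set.encard_ne_top_iff.1 this
  have hfin : {i | s (U i ω) ≠ 0}.Finite := by
    refine ((s.range.filter (· ≠ 0)).finite_toSet.biUnion hfib).subset fun i hi => ?_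
    simp only [Set.mem_iUnion]
    exact ⟨s (U i ω), by simpa using hi, rfl⟩
  rw [tprod_eq_prod (s := hfin.toFinset) (fun i hi => by
    have : s (U i ω) = 0 := by simpa using hi
    simp [this])]
  rw [← Finset.prod_fiberwise_of_maps_to (g := fun i => s (U i ω))
    (t := s.range.filter (· ≠ 0)) (fun i hi => by simpa using hi)]
  refine Finset.prod_congr rfl fun c hc => ?_
  rw [sum_dirac_apply_eq_encard U (s.measurableSet_fiber c)]
  have hset : {i | U i ω ∈ s ⁻¹' {c}} = ↑(hfin.toFinset.filter (fun i => s (U i ω) = c)) := by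
    ext i
    have hc0 : c ≠ 0 := (Finset.mem_filter.1 hc).2
    simp only [Set.mem_preimage, Set.mem_singleton_iff, Set.mem_ofPred_eq, Finset.coe_filter,
      Set.Finite.mem_toFinset]
    exact ⟨fun h => ⟨by rw [h]; exact hc0, h⟩, fun h => h.2⟩
  rw [hset, Set.encard_coe_eq_coe_finsetCard]
  simp only [ENat.toENNReal_coe, ENNReal.toReal_natCast, ENNReal.rpow_natCast]
  refine Finset.prod_eq_pow_card fun i hi => ?_
  rw [(Finset.mem_filter.1 hi).2]

/-- The fibres of `s` are disjoint, so their counts are independent Poisson variables and the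
expectation is a product of probability generating functions. -/
lemma IsPoissonPointProcess.lintegral_tprod_one_sub_simpleFunc {E Ω : Type*} [MeasurableSpace E]
    [MeasurableSpace Ω] {P : Measure Ω} {U : ℕ → Ω → E} {ν : Measure E}
    (hU : IsPoissonPointProcess P U ν) (s : SimpleFunc E ℝ≥0∞) (hs1 : ∀ x, s x ≤ 1)
    (hs : ∀ c, c ≠ 0 → ν (s ⁻¹' {c}) ≠ ∞) :
    ∫⁻ ω, ∏' i, (1 - s (U i ω)) ∂P
      = ENNReal.ofReal (Real.exp (-(∫⁻ x, s x ∂ν).toReal)) := by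
  classical
  set R := s.range.filter (· ≠ 0) with hR
  set N : ℝ≥0∞ → Ω → ℝ≥0∞ :=
    fun c ω => Measure.sum (fun i => Measure.dirac (U i ω)) (s ⁻¹' {c}) with hN
  have hR0 : ∀ c ∈ R, c ≠ 0 := fun c hc => (Finset.mem_filter.1 hc).2
  have hR1 : ∀ c ∈ R, c ≤ 1 := by
    intro c hc
    obtain ⟨x, rfl⟩ := SimpleFunc.mem_range.1 (Finset.mem_filter.1 hc).1
    exact hs1 x
  have hfin : ∀ᵐ ω ∂P, ∀ c ∈ R, N c ω ≠ ∞ :=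
    (ae_ball_iff R.countable_toSet).2 fun c hc =>
      hU.ae_count_lt_top (s.measurableSet_fiber c) (hs c (hR0 c hc))
  have h1 : ∫⁻ ω, ∏' i, (1 - s (U i ω)) ∂P = ∫⁻ ω, ∏ c ∈ R, (1 - c) ^ (N c ω).toReal ∂P := by
    refine lintegral_congr_ae ?_
    filter_upwards [hfin] with ω hω
    exact tprod_one_sub_simpleFunc U s ω hω
  have hind : iIndepFun (fun (j : Fin R.card) ω => N (R.equivFin.symm j) ω) P := by
    refine hU.indep_count R.card (fun j => s ⁻¹' {(R.equivFin.symm j : ℝ≥0∞)})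
      (fun j => s.measurableSet_fiber _) fun i j hij => ?_
    refine Disjoint.preimage _ (Set.disjoint_singleton.2 fun h => hij ?_)
    exact R.equivFin.symm.injective (Subtype.ext h)
  have hNm : ∀ c, Measurable (N c) := fun c =>
    measurable_sum_dirac_apply hU.measurable (s.measurableSet_fiber c)
  have h2 : ∀ ω, ∏ c ∈ R, (1 - c) ^ (N c ω).toReal
      = ∏ j : Fin R.card, (1 - (R.equivFin.symm j : ℝ≥0∞)) ^ (N (R.equivFin.symm j) ω).toReal := by
    intro ω
    rw [← Finset.prod_coe_sort R]
    exact (Equiv.prod_comp R.equivFin.symm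
      (fun c : R => (1 - (c : ℝ≥0∞)) ^ (N c ω).toReal)).symm
  have hind' := hind.comp (fun j x => (1 - (R.equivFin.symm j : ℝ≥0∞)) ^ x.toReal)
    (fun j => by fun_prop)
  have h3 := lintegral_prod_eq_prod_lintegral_of_indepFun Finset.univ _ hind'
    (fun j => by
      have := hNm (R.equivFin.symm j)
      simp only [Function.comp_def]
      fun_prop)
  simp only [Function.comp_def] at h3
  rw [h1]
  simp_rw [h2]
  rw [h3, Equiv.prod_comp R.equivFin.symm
      (fun c : R => ∫⁻ ω, (1 - (c : ℝ≥0∞)) ^ (N c ω).toReal ∂P),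
    Finset.prod_coe_sort R (fun c => ∫⁻ ω, (1 - (c : ℝ≥0∞)) ^ (N c ω).toReal ∂P)]
  have h4 : ∀ c ∈ R, ∫⁻ ω, (1 - (c : ℝ≥0∞)) ^ (N c ω).toReal ∂P
      = ENNReal.ofReal (Real.exp (-(c * ν (s ⁻¹' {c})).toReal)) := by
    intro c hc
    rw [(hU.hasLaw_count _ (s.measurableSet_fiber c) (hs c (hR0 c hc))).lintegral_comp
      (f := fun x => (1 - c) ^ x.toReal) (by fun_prop),
      lintegral_rpow_map_cast_poissonMeasure _ tsub_le_self,
      ENNReal.toReal_sub_of_le (hR1 c hc) ENNReal.one_ne_top, ENNReal.toReal_mul]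
    simp only [ENNReal.toReal_one, sub_sub_cancel, ENNReal.coe_toNNReal_eq_toReal]
    rw [mul_comm]
  rw [Finset.prod_congr rfl h4, ← ENNReal.ofReal_prod_of_nonneg (fun _ _ => (Real.exp_pos _).le),
    ← Real.exp_sum, Finset.sum_neg_distrib, ← ENNReal.toReal_sum
      (f := fun c => c * ν (s ⁻¹' {c})) (fun c hc => ENNReal.mul_ne_top
        (ne_top_of_le_ne_top ENNReal.one_ne_top (hR1 c hc)) (hs c (hR0 c hc))),
    SimpleFunc.lintegral_eq_lintegral, SimpleFunc.lintegral, hR, Finset.sum_filter]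
  congr 4
  refine Finset.sum_congr rfl fun c _ => ?_
  by_cases hc : c = 0 <;> simp [hc]

/-- The generating functional of a Poisson point process. -/
lemma IsPoissonPointProcess.lintegral_tprod_one_sub {E Ω : Type*} [MeasurableSpace E]
    [MeasurableSpace Ω] {P : Measure Ω} [IsProbabilityMeasure P] {U : ℕ → Ω → E} {ν : Measure E}
    (hU : IsPoissonPointProcess P U ν) {g : E → ℝ≥0∞} (hg : Measurable g) (hg1 : ∀ x, g x ≤ 1)
    (hgν : ∫⁻ x, g x ∂ν ≠ ∞) :
    ∫⁻ ω, ∏' i, (1 - g (U i ω)) ∂P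
      = ENNReal.ofReal (Real.exp (-(∫⁻ x, g x ∂ν).toReal)) := by
  have hle : ∀ n x, SimpleFunc.eapprox g n x ≤ g x := fun n x => by
    rw [← SimpleFunc.iSup_eapprox_apply hg x]
    exact le_iSup (fun n => SimpleFunc.eapprox g n x) n
  have hlim : ∀ x, Tendsto (fun n => SimpleFunc.eapprox g n x) atTop (𝓝 (g x)) := fun x => by
    rw [← SimpleFunc.iSup_eapprox_apply hg x]
    exact tendsto_atTop_iSup fun m n hmn => SimpleFunc.monotone_eapprox g hmn x
  have h1 : ∀ n, ∫⁻ ω, ∏' i, (1 - SimpleFunc.eapprox g n (U i ω)) ∂P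
      = ENNReal.ofReal (Real.exp (-(∫⁻ x, SimpleFunc.eapprox g n x ∂ν).toReal)) := by
    intro n
    refine hU.lintegral_tprod_one_sub_simpleFunc _ (fun x => (hle n x).trans (hg1 x)) ?_
    intro c hc htop
    -- Markov's inequality: a nonzero value taken on a set of infinite measure would make the
    -- integral of `g` infinite.
    have h2 : c * ν (SimpleFunc.eapprox g n ⁻¹' {c}) ≤ ∫⁻ x, g x ∂ν := by
      refine le_trans ?_ (lintegral_mono (hle n))
      refine le_trans ?_ (mul_meas_ge_le_lintegral (SimpleFunc.eapprox g n).measurable c)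
      gcongr
      intro x hx
      exact (Set.mem_singleton_iff.1 hx).ge
    rw [htop, ENNReal.mul_top hc] at h2
    exact hgν (top_le_iff.1 h2)
  have hanti : Antitone fun n ω => ∏' i, (1 - SimpleFunc.eapprox g n (U i ω)) := by
    intro m n hmn ω
    simp only
    rw [ENNReal.tprod_eq_iInf_prod fun _ => tsub_le_self,
      ENNReal.tprod_eq_iInf_prod fun _ => tsub_le_self]
    refine iInf_mono fun F => Finset.prod_le_prod' fun i _ => ?_
    exact tsub_le_tsub_left (SimpleFunc.monotone_eapprox g hmn _) _
  have hinf : ∀ ω, ⨅ n, ∏' i, (1 - SimpleFunc.eapprox g n (U i ω)) = ∏' i, (1 - g (U i ω)) := by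
    intro ω
    simp_rw [ENNReal.tprod_eq_iInf_prod (fun _ => tsub_le_self)]
    -- With factors at most `1`, the infinite product is an infimum over finite subproducts, so the
    -- two infima commute and only finite products need a limit.
    rw [iInf_comm]
    refine iInf_congr fun F => ?_
    refine tendsto_nhds_unique (tendsto_atTop_iInf fun m n hmn =>
      Finset.prod_le_prod' fun i _ =>
        tsub_le_tsub_left (SimpleFunc.monotone_eapprox g hmn _) _) ?_
    refine ENNReal.tendsto_finsetProd_of_ne_top _ (fun i _ => ?_) (fun i _ => by finiteness)
    exact ENNReal.Tendsto.sub tendsto_const_nhds (hlim _) (Or.inl ENNReal.one_ne_top)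
  have hmeas : ∀ n, Measurable fun ω => ∏' i, (1 - SimpleFunc.eapprox g n (U i ω)) := by
    intro n
    simp_rw [ENNReal.tprod_eq_iInf_prod (fun _ => tsub_le_self)]
    refine Measurable.iInf fun F => Finset.measurable_fun_prod _ fun i _ => ?_
    exact measurable_const.sub ((SimpleFunc.eapprox g n).measurable.comp (hU.measurable i))
  have hle1 : ∫⁻ ω, ∏' i, (1 - SimpleFunc.eapprox g 0 (U i ω)) ∂P ≠ ∞ := by
    rw [h1]
    exact ENNReal.ofReal_ne_top
  simp_rw [← hinf]
  -- Monotone convergence for a decreasing sequence, which needs one finite integral.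
  rw [lintegral_iInf hmeas hanti hle1]
  refine tendsto_nhds_unique (tendsto_atTop_iInf fun m n hmn => lintegral_mono (hanti hmn)) ?_
  simp_rw [h1]
  refine ENNReal.tendsto_ofReal ((Real.continuous_exp.tendsto _).comp (Tendsto.neg ?_))
  refine (ENNReal.tendsto_toReal hgν).comp ?_
  exact lintegral_tendsto_of_tendsto_of_monotone
    (fun n => (SimpleFunc.eapprox g n).measurable.aemeasurable)
    (ae_of_all _ fun x m n hmn => SimpleFunc.monotone_eapprox g hmn x) (ae_of_all _ hlim)

/-! ### The intensity `du / u²` -/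

instance : SigmaFinite inverseSquareIntensity := by
  unfold inverseSquareIntensity
  exact SigmaFinite.withDensity_ofReal _

lemma inverseSquareIntensity_Ioi {a : ℝ} (ha : 0 < a) :
    inverseSquareIntensity (Set.Ioi a) = ENNReal.ofReal a⁻¹ := by
  rw [inverseSquareIntensity, withDensity_apply _ measurableSet_Ioi,
    Measure.restrict_restrict measurableSet_Ioi,
    Set.inter_eq_left.2 (Set.Ioi_subset_Ioi ha.le)]
  have hcongr : Set.EqOn (fun u : ℝ => u ^ (-2 : ℝ)) (fun u => 1 / u ^ 2) (Set.Ioi a) := by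
    intro u hu
    have hu0 : 0 < u := ha.trans hu
    simp only
    rw [Real.rpow_neg hu0.le, one_div]
    norm_cast
  have hint : IntegrableOn (fun u : ℝ => 1 / u ^ 2) (Set.Ioi a) :=
    (integrableOn_Ioi_rpow_of_lt (by norm_num) ha).congr_fun hcongr measurableSet_Ioi
  rw [← ofReal_integral_eq_lintegral_ofReal hint
    (ae_of_all _ fun u => by positivity), ← setIntegral_congr_fun measurableSet_Ioi hcongr,
    integral_Ioi_rpow_of_lt (by norm_num) ha]
  congr 1
  norm_num
  rw [Real.rpow_neg_one]

lemma inverseSquareIntensity_Iic_zero : inverseSquareIntensity (Set.Iic 0) = 0 := by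
  rw [inverseSquareIntensity, withDensity_apply _ measurableSet_Iic,
    Measure.restrict_restrict measurableSet_Iic, Set.Iic_inter_Ioi, Set.Ioc_self,
    Measure.restrict_empty, lintegral_zero_measure]

/-- This is where expectations enter: integrated over a random mark `b`, the exceedance mass becomes
the mean of `b`. -/
lemma inverseSquareIntensity_setOf_one_lt_mul {b : ℝ} (hb : 0 ≤ b) :
    inverseSquareIntensity {u | 1 < u * b} = ENNReal.ofReal b := by
  rcases hb.eq_or_lt with rfl | hb
  · have : {u : ℝ | 1 < u * 0} = ∅ := by
      ext u
      simp only [mul_zero, Set.mem_ofPred_eq, Set.mem_empty_iff_false, iff_false, not_lt]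
      exact zero_le_one
    rw [this, measure_empty, ENNReal.ofReal_zero]
  · have : {u : ℝ | 1 < u * b} = Set.Ioi b⁻¹ := by
      ext u
      simp only [Set.mem_ofPred_eq, Set.mem_Ioi]
      rw [← one_div, div_lt_iff₀ hb]
    rw [this, inverseSquareIntensity_Ioi (inv_pos.2 hb), inv_inv]

/-! ### Max-stable fields in terms of their spectral functions -/

/-- No sign condition on `u` is needed, as `1 < u * a j` with `0 ≤ a j` forces `0 < u`. For empty
`ι` the supremum is `0` and both sides fail. -/
lemma one_lt_mul_ciSup_iff {ι : Type*} [Finite ι] {a : ι → ℝ} (ha : ∀ j, 0 ≤ a j) (u : ℝ) :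
    1 < u * ⨆ j, a j ↔ ∃ j, 1 < u * a j := by
  rcases isEmpty_or_nonempty ι with hι | hι
  · simp only [Real.iSup_of_isEmpty, mul_zero, IsEmpty.exists_iff, iff_false, not_lt]
    exact zero_le_one
  · constructor
    · intro h
      obtain ⟨j, hj⟩ := exists_eq_ciSup_of_finite (f := a)
      exact ⟨j, by rwa [hj]⟩
    · rintro ⟨j, hj⟩
      have hu : 0 < u := pos_of_mul_pos_left (zero_lt_one.trans hj) (ha j)
      refine hj.trans_le ?_
      gcongr
      exact le_ciSup (Set.finite_range a).bddAbove j

lemma one_lt_mul_one_div_mul_iff {u y e : ℝ} (hy : 0 < y) :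
    1 < u * (1 / y * e) ↔ y < u * e := by
  rw [show u * (1 / y * e) = u * e / y by ring, one_lt_div hy]

/-- Probability that all points of a Poisson process with intensity `du / u²`, multiplied by
independent marks, are at most `1`. -/
lemma IsPoissonPointProcess.measure_forall_mul_le_one {Ω : Type*} [MeasurableSpace Ω]
    {P : Measure Ω} [IsProbabilityMeasure P] {U : ℕ → Ω → ℝ}
    (hU : IsPoissonPointProcess P U inverseSquareIntensity)
    {M : ℕ → Ω → ℝ} (hM : ∀ i, Measurable (M i)) {ρ : Measure ℝ} [IsProbabilityMeasure ρ]
    (hρ : ∀ i, P.map (M i) = ρ) (hρ0 : ∀ᵐ m ∂ρ, 0 ≤ m)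
    (hρ1 : ∫⁻ m, ENNReal.ofReal m ∂ρ ≠ ∞)
    (hind : iIndepFun M P) (hMU : IndepFun (fun ω i => M i ω) (fun ω i => U i ω) P) :
    P {ω | ∀ i, U i ω * M i ω ≤ 1}
      = ENNReal.ofReal (Real.exp (-(∫⁻ m, ENNReal.ofReal m ∂ρ).toReal)) := by
  -- The conditional probability, given a point at `u`, that its marked value exceeds `1`.
  set g : ℝ → ℝ≥0∞ := fun u => ρ {m | 1 < u * m} with hg_def
  have hset : MeasurableSet {p : ℝ × ℝ | 1 < p.1 * p.2} :=
    measurableSet_lt measurable_const (by fun_prop)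
  have hg : Measurable g := measurable_measure_prodMk_left hset
  have hgν : ∫⁻ u, g u ∂inverseSquareIntensity = ∫⁻ m, ENNReal.ofReal m ∂ρ := by
    have h1 : ∫⁻ u, g u ∂inverseSquareIntensity
        = (inverseSquareIntensity.prod ρ) {p : ℝ × ℝ | 1 < p.1 * p.2} :=
      (Measure.prod_apply hset).symm
    rw [h1, Measure.prod_apply_symm hset]
    refine lintegral_congr_ae ?_
    filter_upwards [hρ0] with m hm
    exact inverseSquareIntensity_setOf_one_lt_mul hm
  have hsub : ∀ u, ρ {m | u * m ≤ 1} = 1 - g u := by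
    intro u
    have : {m : ℝ | u * m ≤ 1} = {m | 1 < u * m}ᶜ := by
      ext m
      simp
    rw [this, prob_compl_eq_one_sub (measurableSet_lt measurable_const (by fun_prop))]
  rw [← hgν, ← hU.lintegral_tprod_one_sub hg (fun u => prob_le_one) (by rwa [hgν])]
  have hUm := hU.measurable
  have hMm : Measurable fun ω i => M i ω := by fun_prop
  have hUm' : Measurable fun ω i => U i ω := by fun_prop
  have hmap := (indepFun_iff_map_prod_eq_prod_map_map hMm.aemeasurable hUm'.aemeasurable).1 hMU
  have hpi := (iIndepFun_iff_map_fun_eq_infinitePi_map hM).1 hind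
  simp_rw [hρ] at hpi
  have hS : MeasurableSet {p : (ℕ → ℝ) × (ℕ → ℝ) | ∀ i, p.2 i * p.1 i ≤ 1} := by
    simp only [Set.ofPred_forall]
    exact MeasurableSet.iInter fun i => measurableSet_le (by fun_prop) measurable_const
  have h2 : P {ω | ∀ i, U i ω * M i ω ≤ 1}
      = (P.map fun ω => ((fun i => M i ω), (fun i => U i ω)))
        {p : (ℕ → ℝ) × (ℕ → ℝ) | ∀ i, p.2 i * p.1 i ≤ 1} := by
    rw [Measure.map_apply (hMm.prodMk hUm') hS]
    rfl
  have : IsProbabilityMeasure (P.map fun ω i => U i ω) :=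
    Measure.isProbabilityMeasure_map hUm'.aemeasurable
  have : IsProbabilityMeasure (P.map fun ω i => M i ω) :=
    Measure.isProbabilityMeasure_map hMm.aemeasurable
  -- Given the points, the marks are i.i.d. with law `ρ`, so the conditional probability of the
  -- event is the infinite product of `1 - g (U i)`.
  rw [h2, hmap, Measure.prod_apply_symm hS, lintegral_map (measurable_measure_prodMk_right hS) hUm']
  refine lintegral_congr fun ω => ?_
  rw [hpi]
  have h3 : (fun x : ℕ → ℝ => (x, fun i => U i ω)) ⁻¹'
      {p : (ℕ → ℝ) × (ℕ → ℝ) | ∀ i, p.2 i * p.1 i ≤ 1}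
      = Set.univ.pi fun i => {m | U i ω * m ≤ 1} := by
    ext x
    simp
  rw [h3, Measure.infinitePi_pi_univ _ fun i => measurableSet_le (by fun_prop) measurable_const]
  exact tprod_congr fun i => hsub _

/-- The marks `ξ 0, ξ 1, …` are independent copies of the positive spectral field `η`, whose
margins have mean one, and they are independent of the Poisson points `U 0, U 1, …` of
intensity `du / u²`. -/
structure IsSpectralRepresentation {T Ω₀ Ω : Type*} [MeasurableSpace Ω₀] [MeasurableSpace Ω]
    (P₀ : Measure Ω₀) (P : Measure Ω) (η : T → Ω₀ → ℝ) (U : ℕ → Ω → ℝ) (ξ : ℕ → T → Ω → ℝ) :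
    Prop where
  poisson : IsPoissonPointProcess P U inverseSquareIntensity
  measurable_spectral : ∀ t, Measurable (η t)
  spectral_pos : ∀ t ω, 0 < η t ω
  lintegral_spectral : ∀ t, ∫⁻ ω, ENNReal.ofReal (η t ω) ∂P₀ = 1
  measurable_mark : ∀ i t, Measurable (ξ i t)
  mark_pos : ∀ i t ω, 0 < ξ i t ω
  identDistrib : ∀ i, IdentDistrib (fun ω t => ξ i t ω) (fun ω t => η t ω) P P₀
  iIndep : iIndepFun (fun i ω t => ξ i t ω) P
  indep : IndepFun (fun ω i t => ξ i t ω) (fun ω i => U i ω) P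

/-- The field `(u, ω) ↦ u η(ω)`, whose law under `du / u² ⊗ P₀` is the exponent measure of the
max-stable field with spectral field `η`. -/
noncomputable def exponentField {T Ω₀ : Type*} (η : T → Ω₀ → ℝ) (t : T)
    (p : ℝ × Ω₀) : ℝ :=
  p.1 * η t p.2

/-- The max-stable field with Poisson points `U` and marks `ξ`. -/
noncomputable def maxStableField {T Ω : Type*} (U : ℕ → Ω → ℝ) (ξ : ℕ → T → Ω → ℝ) (t : T)
    (ω : Ω) : ℝ :=
  ⨆ i, U i ω * ξ i t ω

namespace IsSpectralRepresentation

set_option linter.unusedSectionVars false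

variable {T Ω₀ Ω : Type*} [MeasurableSpace Ω₀] [MeasurableSpace Ω]
  {P₀ : Measure Ω₀} [IsProbabilityMeasure P₀] {P : Measure Ω} [IsProbabilityMeasure P]
  {η : T → Ω₀ → ℝ} {U : ℕ → Ω → ℝ} {ξ : ℕ → T → Ω → ℝ}
  (h : IsSpectralRepresentation P₀ P η U ξ)

include h

lemma measurable_exponentField (t : T) : Measurable (exponentField η t) :=
  measurable_fst.mul ((h.measurable_spectral t).comp measurable_snd)

lemma measurable_maxStableField (t : T) : Measurable (maxStableField U ξ t) :=
  Measurable.iSup fun i => (h.poisson.measurable i).mul (h.measurable_mark i t)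

lemma ae_forall_pos : ∀ᵐ ω ∂P, ∀ i, 0 < U i ω := by
  filter_upwards [h.poisson.ae_notMem measurableSet_Iic inverseSquareIntensity_Iic_zero]
    with ω hω i
  exact not_le.1 (hω i)

lemma ae_exponentField_pos :
    ∀ᵐ p ∂(inverseSquareIntensity.prod P₀), ∀ t, 0 < exponentField η t p := by
  have h0 : (inverseSquareIntensity.prod P₀) (Set.Iic (0 : ℝ) ×ˢ (Set.univ : Set Ω₀)) = 0 := by
    rw [Measure.prod_prod, inverseSquareIntensity_Iic_zero, zero_mul]
  filter_upwards [measure_eq_zero_iff_ae_notMem.1 h0] with p hp t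
  refine mul_pos ?_ (h.spectral_pos t _)
  by_contra hneg
  exact hp ⟨not_lt.1 hneg, Set.mem_univ _⟩

section Finite

variable {ι : Type*} [Finite ι] (t : ι → T) {y : ι → ℝ} (hy : ∀ j, 0 < y j)

include hy in
lemma setOf_exists_lt_exponentField :
    {p | ∃ j, y j < exponentField η (t j) p}
      = {p : ℝ × Ω₀ | 1 < p.1 * ⨆ j, 1 / y j * η (t j) p.2} := by
  ext p
  have h0 : ∀ j, 0 ≤ 1 / y j * η (t j) p.2 := fun j =>
    mul_nonneg (one_div_pos.2 (hy j)).le (h.spectral_pos _ _).le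
  simp only [Set.mem_ofPred_eq, one_lt_mul_ciSup_iff h0, exponentField,
    one_lt_mul_one_div_mul_iff (hy _)]

omit [Finite ι] in
lemma measurableSet_exists_lt_exponentField [Countable ι] (y : ι → ℝ) :
    MeasurableSet {p | ∃ j, y j < exponentField η (t j) p} := by
  simp only [Set.ofPred_exists]
  exact MeasurableSet.iUnion fun j =>
    measurableSet_lt measurable_const (h.measurable_exponentField _)

include hy in
lemma measure_exists_lt_exponentField :
    (inverseSquareIntensity.prod P₀) {p | ∃ j, y j < exponentField η (t j) p}
      = ∫⁻ ω, ENNReal.ofReal (⨆ j, 1 / y j * η (t j) ω) ∂P₀ := by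
  rw [Measure.prod_apply_symm (h.measurableSet_exists_lt_exponentField t y)]
  refine lintegral_congr fun ω => ?_
  rw [h.setOf_exists_lt_exponentField t hy]
  exact inverseSquareIntensity_setOf_one_lt_mul (Real.iSup_nonneg fun j =>
    mul_nonneg (one_div_pos.2 (hy j)).le (h.spectral_pos _ _).le)

lemma measure_lt_exponentField (t : T) {y : ℝ} (hy : 0 < y) :
    (inverseSquareIntensity.prod P₀) {p | y < exponentField η t p} = ENNReal.ofReal (1 / y) := by
  have h1 := h.measure_exists_lt_exponentField (fun _ : Unit => t) (y := fun _ => y) (fun _ => hy)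
  simp only [exists_const, ciSup_const] at h1
  rw [h1]
  simp_rw [ENNReal.ofReal_mul (one_div_pos.2 hy).le]
  rw [lintegral_const_mul _ (h.measurable_spectral t).ennreal_ofReal, h.lintegral_spectral, mul_one]

include hy in
lemma measure_exists_lt_exponentField_ne_top :
    (inverseSquareIntensity.prod P₀) {p | ∃ j, y j < exponentField η (t j) p} ≠ ∞ := by
  have := Fintype.ofFinite ι
  simp only [Set.ofPred_exists]
  refine ne_top_of_le_ne_top ?_ (measure_iUnion_le _)
  rw [tsum_fintype]
  refine ENNReal.sum_ne_top.2 fun j _ => ?_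
  rw [h.measure_lt_exponentField _ (hy j)]
  exact ENNReal.ofReal_ne_top

include hy in
-- The maxima `φ` of the rescaled marks are themselves i.i.d. scalar marks, which reduces the joint
-- event to `IsPoissonPointProcess.measure_forall_mul_le_one`.
lemma measure_forall_mul_ciSup_le_one :
    P {ω | ∀ i, U i ω * ⨆ j, 1 / y j * ξ i (t j) ω ≤ 1}
      = ENNReal.ofReal (Real.exp
          (-(inverseSquareIntensity.prod P₀).real {p | ∃ j, y j < exponentField η (t j) p})) := by
  set φ : (T → ℝ) → ℝ := fun z => ⨆ j, 1 / y j * z (t j) with hφ_def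
  have hφ : Measurable φ := Measurable.iSup fun j => (measurable_pi_apply _).const_mul _
  have hηm : Measurable fun ω t => η t ω := measurable_pi_lambda _ h.measurable_spectral
  have hξm : ∀ i, Measurable fun ω t => ξ i t ω := fun i =>
    measurable_pi_lambda _ (h.measurable_mark i)
  have hlaw : ∀ i, P.map (fun ω => φ fun t => ξ i t ω) = P₀.map (fun ω => φ fun t => η t ω) :=
    fun i => ((h.identDistrib i).comp hφ).map_eq
  have : IsProbabilityMeasure (P₀.map (fun ω => φ fun t => η t ω)) :=
    Measure.isProbabilityMeasure_map (hφ.comp hηm).aemeasurable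
  have hint : ∫⁻ m, ENNReal.ofReal m ∂(P₀.map (fun ω => φ fun t => η t ω))
      = (inverseSquareIntensity.prod P₀) {p | ∃ j, y j < exponentField η (t j) p} := by
    rw [h.measure_exists_lt_exponentField t hy,
      lintegral_map (g := fun ω => φ fun t => η t ω) ENNReal.measurable_ofReal (hφ.comp hηm)]
  have key := h.poisson.measure_forall_mul_le_one (M := fun i ω => φ fun t => ξ i t ω)
    (fun i => hφ.comp (hξm i)) hlaw
    ((ae_map_iff (hφ.comp hηm).aemeasurable measurableSet_Ici).2 (ae_of_all _ fun ω =>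
      Real.iSup_nonneg fun j => mul_nonneg (one_div_pos.2 (hy j)).le (h.spectral_pos _ _).le))
    (by
      rw [hint]
      exact h.measure_exists_lt_exponentField_ne_top t hy)
    (h.iIndep.comp (fun _ => φ) fun _ => hφ)
    (h.indep.comp (φ := fun (z : ℕ → T → ℝ) i => φ (z i)) (ψ := id)
      (measurable_pi_lambda _ fun i => hφ.comp (measurable_pi_apply i)) measurable_id)
  rw [hint] at key
  exact key

omit [Finite ι] in
-- If the values are unbounded, some point exceeds `n + 1`, an event of probability `1 - exp (-1 /
-- (n + 1))` for each `n`. Boundedness matters because a real supremum over an unbounded family is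
-- `0` by convention.
lemma ae_bddAbove (t : T) : ∀ᵐ ω ∂P, BddAbove (Set.range fun i => U i ω * ξ i t ω) := by
  have h1 : ∀ n : ℕ, P {ω | ¬ BddAbove (Set.range fun i => U i ω * ξ i t ω)}
      ≤ 1 - ENNReal.ofReal (Real.exp (-(1 / ((n : ℝ) + 1)))) := by
    intro n
    have hn : (0 : ℝ) < n + 1 := by positivity
    have h2 := h.measure_forall_mul_ciSup_le_one (fun _ : Unit => t) (y := fun _ => (n : ℝ) + 1)
      (fun _ => hn)
    simp only [ciSup_const, exists_const] at h2
    rw [measureReal_def, h.measure_lt_exponentField t hn,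
      ENNReal.toReal_ofReal (by positivity)] at h2
    rw [← h2, ← prob_compl_eq_one_sub]
    · refine measure_mono fun ω hω hall => hω ⟨(n : ℝ) + 1, ?_⟩
      rintro _ ⟨i, rfl⟩
      have := hall i
      rwa [← not_lt, one_lt_mul_one_div_mul_iff hn, not_lt] at this
    · simp only [Set.ofPred_forall]
      exact MeasurableSet.iInter fun i => measurableSet_le ((h.poisson.measurable i).mul
        ((h.measurable_mark i t).const_mul _)) measurable_const
  have hlim : Tendsto (fun n : ℕ => 1 - ENNReal.ofReal (Real.exp (-(1 / ((n : ℝ) + 1))))) atTop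
      (𝓝 0) := by
    have h3 : Tendsto (fun n : ℕ => Real.exp (-(1 / ((n : ℝ) + 1)))) atTop (𝓝 1) := by
      have := (Real.continuous_exp.tendsto _).comp
        (tendsto_one_div_add_atTop_nhds_zero_nat (𝕜 := ℝ)).neg
      simpa [Function.comp_def] using this
    have h4 := ENNReal.Tendsto.sub (tendsto_const_nhds (x := (1 : ℝ≥0∞)))
      (ENNReal.tendsto_ofReal h3) (Or.inl ENNReal.one_ne_top)
    simpa using h4
  exact le_antisymm (ge_of_tendsto' hlim h1) bot_le

lemma ae_maxStableField_pos (t : T) : ∀ᵐ ω ∂P, 0 < maxStableField U ξ t ω := by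
  filter_upwards [h.ae_forall_pos, h.ae_bddAbove t] with ω hpos hbdd
  exact (mul_pos (hpos 0) (h.mark_pos 0 t ω)).trans_le (le_ciSup hbdd 0)

include hy in
lemma measure_forall_maxStableField_le :
    P {ω | ∀ j, maxStableField U ξ (t j) ω ≤ y j}
      = ENNReal.ofReal (Real.exp
          (-(inverseSquareIntensity.prod P₀).real {p | ∃ j, y j < exponentField η (t j) p})) := by
  rw [← h.measure_forall_mul_ciSup_le_one t hy]
  refine measure_congr ?_
  filter_upwards [ae_all_iff.2 fun j => h.ae_bddAbove (t j)] with ω hω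
  refine propext ?_
  change (∀ j, maxStableField U ξ (t j) ω ≤ y j)
    ↔ ∀ i, U i ω * ⨆ j, 1 / y j * ξ i (t j) ω ≤ 1
  have h0 : ∀ i j, 0 ≤ 1 / y j * ξ i (t j) ω := fun i j =>
    mul_nonneg (one_div_pos.2 (hy j)).le (h.mark_pos _ _ _).le
  simp_rw [← not_lt (a := (1 : ℝ)), one_lt_mul_ciSup_iff (h0 _), one_lt_mul_one_div_mul_iff (hy _),
    not_exists, not_lt]
  rw [forall_comm]
  exact forall_congr' fun j => ciSup_le_iff (hω j)

include hy in
-- Homogeneity of order `-1` of the exponent measure; in terms of expectations it is linearity.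
lemma real_exists_mul_lt_exponentField {x : ℝ} (hx : 0 < x) :
    (inverseSquareIntensity.prod P₀).real {p | ∃ j, x * y j < exponentField η (t j) p}
      = (inverseSquareIntensity.prod P₀).real {p | ∃ j, y j < exponentField η (t j) p} / x := by
  rw [measureReal_def, measureReal_def,
    h.measure_exists_lt_exponentField t fun j => mul_pos hx (hy j),
    h.measure_exists_lt_exponentField t hy]
  have h1 : ∀ ω, ENNReal.ofReal (⨆ j, 1 / (x * y j) * η (t j) ω)
      = ENNReal.ofReal x⁻¹ * ENNReal.ofReal (⨆ j, 1 / y j * η (t j) ω) := by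
    intro ω
    rw [← ENNReal.ofReal_mul (inv_pos.2 hx).le, Real.mul_iSup_of_nonneg (inv_pos.2 hx).le]
    congr 2
    ext j
    rw [one_div, one_div, mul_inv, mul_assoc]
  simp_rw [h1]
  rw [lintegral_const_mul, ENNReal.toReal_mul, ENNReal.toReal_ofReal (inv_pos.2 hx).le]
  · ring
  · exact (Measurable.iSup fun j =>
      (h.measurable_spectral (t j)).const_mul _).ennreal_ofReal

include hy in
/-- The exceedance probabilities of the max-stable field are asymptotically those of the exponent
measure. -/
lemma tendsto_mul_real_exists_lt :
    Tendsto (fun x : ℝ => x * P.real {ω | ∃ j, x * y j < maxStableField U ξ (t j) ω}) atTop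
      (𝓝 ((inverseSquareIntensity.prod P₀).real {p | ∃ j, y j < exponentField η (t j) p})) := by
  set v := (inverseSquareIntensity.prod P₀).real {p | ∃ j, y j < exponentField η (t j) p}
  have h1 : ∀ x : ℝ, 0 < x →
      P.real {ω | ∃ j, x * y j < maxStableField U ξ (t j) ω} = 1 - Real.exp (-v * x⁻¹) := by
    intro x hx
    have h2 := h.measure_forall_maxStableField_le t fun j => mul_pos hx (hy j)
    rw [h.real_exists_mul_lt_exponentField t hy hx] at h2
    have h3 : {ω | ∃ j, x * y j < maxStableField U ξ (t j) ω}
        = {ω | ∀ j, maxStableField U ξ (t j) ω ≤ x * y j}ᶜ := by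
      ext ω
      simp
    rw [h3, measureReal_compl, measureReal_def, measureReal_def, h2,
      ENNReal.toReal_ofReal (Real.exp_pos _).le, measure_univ, ENNReal.toReal_one]
    · rw [neg_mul, div_eq_mul_inv]
    · simp only [Set.ofPred_forall]
      exact MeasurableSet.iInter fun j =>
        measurableSet_le (h.measurable_maxStableField _) measurable_const
  -- With `s = 1 / x`, the limit is the derivative of `1 - exp (-v * s)` at `0`.
  have hd : HasDerivAt (fun s : ℝ => 1 - Real.exp (-v * s)) v 0 := by
    have := (((hasDerivAt_id (0 : ℝ)).const_mul (-v)).exp).const_sub 1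
    simpa using this
  have h4 := (hasDerivAt_iff_tendsto_slope.1 hd).comp
    (tendsto_inv_atTop_nhdsGT_zero.mono_right
      (nhdsWithin_mono (0 : ℝ) fun s (hs : 0 < s) => hs.ne'))
  refine h4.congr' ?_
  filter_upwards [eventually_gt_atTop 0] with x hx
  rw [h1 x hx]
  simp [slope_def_field, mul_comm]

end Finite

end IsSpectralRepresentation

/-! ### Weak convergence from convergence of distribution functions -/

lemma isPiSystem_range_Iic {ι : Type*} : IsPiSystem (Set.range fun y : ι → ℝ => Set.Iic y) := by
  rintro _ ⟨y, rfl⟩ _ ⟨z, rfl⟩ -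
  exact ⟨y ⊓ z, by rw [Set.Iic_inter_Iic]⟩

lemma isPiSystem_range_pi_Ioc {ι : Type*} :
    IsPiSystem (Set.range fun p : (ι → ℝ) × (ι → ℝ) =>
      Set.univ.pi fun i => Set.Ioc (p.1 i) (p.2 i)) := by
  rintro _ ⟨p, rfl⟩ _ ⟨q, rfl⟩ -
  refine ⟨(p.1 ⊔ q.1, p.2 ⊓ q.2), ?_⟩
  simp only [← Set.pi_inter_distrib, Set.Ioc_inter_Ioc]
  rfl

/-- A box is a lower orthant minus the orthants cut in one coordinate. Using `min (a j) (b j)`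
instead of `a j` keeps the removed orthants inside `Iic b` even if the box is empty, so that
measures can be subtracted. -/
lemma pi_Ioc_eq_Iic_diff {ι : Type*} [Fintype ι] [DecidableEq ι] (a b : ι → ℝ) :
    (Set.univ.pi fun i => Set.Ioc (a i) (b i)) = Set.Iic b \
      ⋃ s ∈ Finset.univ.image (fun j => Set.Iic (Function.update b j (min (a j) (b j)))), s := by
  ext z
  simp only [Set.mem_pi, Set.mem_univ, true_imp_iff, Set.mem_Ioc, Finset.mem_image,
    Finset.mem_univ, true_and, Set.mem_sdiff, Set.mem_Iic, Set.mem_iUnion, not_exists]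
  constructor
  · intro hz
    refine ⟨fun i => (hz i).2, ?_⟩
    rintro _ ⟨j, rfl⟩ hj
    have h1 := hj j
    rw [Function.update_self] at h1
    exact absurd (h1.trans (min_le_left _ _)) (not_le.2 (hz j).1)
  · rintro ⟨hz, hz'⟩ i
    refine ⟨?_, hz i⟩
    by_contra hi
    refine hz' _ ⟨i, rfl⟩ fun j => ?_
    rcases eq_or_ne j i with rfl | hji
    · rw [Function.update_self]
      exact le_min (not_lt.1 hi) (hz j)
    · rw [Function.update_of_ne hji]
      exact hz j

/-- Probability measures on a finite-dimensional space converge weakly if their distribution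
functions converge at every point. -/
lemma tendsto_probabilityMeasure_of_tendsto_Iic {ι α : Type*} [Fintype ι] {l : Filter α}
    [l.IsCountablyGenerated] {μs : α → ProbabilityMeasure (ι → ℝ)} {μ : ProbabilityMeasure (ι → ℝ)}
    (h : ∀ y, Tendsto (fun i => (μs i : Measure (ι → ℝ)).real (Set.Iic y)) l
      (𝓝 ((μ : Measure (ι → ℝ)).real (Set.Iic y)))) :
    Tendsto μs l (𝓝 μ) := by
  classical
  have hm : ∀ s ∈ Set.range fun y : ι → ℝ => Set.Iic y, MeasurableSet s := by
    rintro _ ⟨y, rfl⟩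
    exact measurableSet_Iic
  -- Half-open boxes form a π-system and provide arbitrarily small neighbourhoods of every point, so
  -- convergence on boxes suffices.
  refine isPiSystem_range_pi_Ioc.tendsto_probabilityMeasure_of_tendsto_of_mem ?_ ?_ ?_
  · rintro _ ⟨p, rfl⟩
    exact MeasurableSet.univ_pi fun i => measurableSet_Ioc
  · intro u hu x hx
    obtain ⟨ε, hε, hball⟩ := Metric.isOpen_iff.1 hu x hx
    refine ⟨_, ⟨(fun i => x i - ε / 2, fun i => x i + ε / 2), rfl⟩, ?_, ?_⟩
    · exact set_pi_mem_nhds Set.finite_univ fun i _ =>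
        Ioc_mem_nhds (by linarith) (by linarith)
    · refine fun z hz => hball ?_
      rw [Metric.mem_ball]
      refine lt_of_le_of_lt ((dist_pi_le_iff (half_pos hε).le).2 fun i => ?_) (half_lt_self hε)
      have := hz i (Set.mem_univ i)
      rw [Real.dist_eq, abs_le]
      constructor <;> linarith [this.1, this.2]
  · rintro _ ⟨p, rfl⟩
    have hsub : (⋃ s ∈ Finset.univ.image
        (fun j => Set.Iic (Function.update p.2 j (min (p.1 j) (p.2 j)))), s) ⊆ Set.Iic p.2 := by
      simp only [Set.iUnion_subset_iff, Finset.mem_image, Finset.mem_univ, true_and]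
      rintro _ ⟨j, rfl⟩
      refine Set.Iic_subset_Iic.2 fun i => ?_
      rcases eq_or_ne i j with rfl | hij
      · simp
      · rw [Function.update_of_ne hij]
    have hmem : ∀ s ∈ Finset.univ.image
        (fun j => Set.Iic (Function.update p.2 j (min (p.1 j) (p.2 j)))),
        s ∈ Set.range fun y : ι → ℝ => Set.Iic y := by
      intro s hs
      obtain ⟨j, -, rfl⟩ := Finset.mem_image.1 hs
      exact ⟨_, rfl⟩
    have hmeas := Finset.measurableSet_biUnion _ fun s hs => hm s (hmem s hs)
    -- Inclusion-exclusion: intersections of lower orthants are again lower orthants.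
    have hlim := (h p.2).sub (isPiSystem_range_Iic.tendsto_measureReal_biUnion
      (μ := fun i => (μs i : Measure (ι → ℝ))) (ν := (μ : Measure (ι → ℝ))) (l := l) hmem hm (by
        rintro _ ⟨y, rfl⟩
        exact h y))
    rw [← NNReal.tendsto_coe]
    simp only [← ProbabilityMeasure.measureReal_eq_coe_coeFn]
    rw [pi_Ioc_eq_Iic_diff]
    have hdiff := fun κ : ProbabilityMeasure (ι → ℝ) =>
      measureReal_sdiff (μ := (κ : Measure (ι → ℝ))) hsub hmeas (measure_ne_top _ _)
    simp only [hdiff]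
    exact hlim

/-- Finite measures on a finite-dimensional space converge weakly to a nonzero measure if their
distribution functions converge at every point and their total masses converge. -/
lemma tendsto_integral_of_tendsto_Iic {ι α : Type*} [Fintype ι] {l : Filter α}
    [l.IsCountablyGenerated] {ρs : α → Measure (ι → ℝ)} [∀ i, IsFiniteMeasure (ρs i)]
    {ρ : Measure (ι → ℝ)} [IsFiniteMeasure ρ] (hρ : ρ ≠ 0)
    (huniv : Tendsto (fun i => (ρs i).real Set.univ) l (𝓝 (ρ.real Set.univ)))
    (hIic : ∀ y, Tendsto (fun i => (ρs i).real (Set.Iic y)) l (𝓝 (ρ.real (Set.Iic y))))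
    (f : (ι → ℝ) →ᵇ ℝ) :
    Tendsto (fun i => ∫ z, f z ∂(ρs i)) l (𝓝 (∫ z, f z ∂ρ)) := by
  set μs : α → FiniteMeasure (ι → ℝ) := fun i => ⟨ρs i, inferInstance⟩
  set μ : FiniteMeasure (ι → ℝ) := ⟨ρ, inferInstance⟩ with hμ_def
  have hμ : μ ≠ 0 := fun h0 => hρ (congrArg Subtype.val h0)
  have hmass : Tendsto (fun i => (μs i).mass) l (𝓝 μ.mass) := NNReal.tendsto_coe.1 huniv
  have hne : ∀ᶠ i in l, μs i ≠ 0 := by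
    filter_upwards [hmass.eventually_ne ((μ.mass_nonzero_iff).2 hμ)] with i hi
    exact ((μs i).mass_nonzero_iff).1 hi
  -- Finite measures with nonzero limit converge once their masses and their normalizations do.
  refine FiniteMeasure.tendsto_iff_forall_integral_tendsto.1
    (FiniteMeasure.tendsto_of_tendsto_normalize_testAgainstNN_of_tendsto_mass
      (μs := μs) (μ := μ) ?_ hmass) f
  refine tendsto_probabilityMeasure_of_tendsto_Iic fun y => ?_
  simp only [ProbabilityMeasure.measureReal_eq_coe_coeFn]
  rw [NNReal.tendsto_coe, μ.normalize_eq_of_nonzero hμ]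
  have hlim : Tendsto (fun i => (μs i).mass⁻¹ * μs i (Set.Iic y)) l
      (𝓝 (μ.mass⁻¹ * μ (Set.Iic y))) :=
    (hmass.inv₀ ((μ.mass_nonzero_iff).2 hμ)).mul (NNReal.tendsto_coe.1 (hIic y))
  refine hlim.congr' ?_
  filter_upwards [hne] with i hi
  exact ((μs i).normalize_eq_of_nonzero hi _).symm

/-! ### Weak convergence of rescaled max-stable vectors on exceedance regions -/

namespace IsSpectralRepresentation

set_option linter.unusedSectionVars false

variable {T Ω₀ Ω : Type*} [MeasurableSpace Ω₀] [MeasurableSpace Ω]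
  {P₀ : Measure Ω₀} [IsProbabilityMeasure P₀] {P : Measure Ω} [IsProbabilityMeasure P]
  {η : T → Ω₀ → ℝ} {U : ℕ → Ω → ℝ} {ξ : ℕ → T → Ω → ℝ}
  (h : IsSpectralRepresentation P₀ P η U ξ)
  {ι : Type*} [Fintype ι] (t : ι → T) {J : Set ι} {δ : ℝ}

include h

lemma measurableSet_exists_mem_lt_exponentField :
    MeasurableSet {p | ∃ j ∈ J, δ < exponentField η (t j) p} := by
  have : {p | ∃ j ∈ J, δ < exponentField η (t j) p}
      = ⋃ j ∈ J, {p | δ < exponentField η (t j) p} := by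
    ext p
    simp
  rw [this]
  exact MeasurableSet.biUnion J.to_countable fun j _ =>
    measurableSet_lt measurable_const (h.measurable_exponentField _)

lemma measurableSet_exists_mem_lt_maxStableField :
    MeasurableSet {ω | ∃ j ∈ J, δ < maxStableField U ξ (t j) ω} := by
  have : {ω | ∃ j ∈ J, δ < maxStableField U ξ (t j) ω}
      = ⋃ j ∈ J, {ω | δ < maxStableField U ξ (t j) ω} := by
    ext p
    simp
  rw [this]
  exact MeasurableSet.biUnion J.to_countable fun j _ =>
    measurableSet_lt measurable_const (h.measurable_maxStableField _)

lemma measure_exists_mem_lt_exponentField_ne_top (hδ : 0 < δ) :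
    (inverseSquareIntensity.prod P₀) {p | ∃ j ∈ J, δ < exponentField η (t j) p} ≠ ∞ := by
  have := h.measure_exists_lt_exponentField_ne_top (fun j : J => t j) (y := fun _ => δ)
    fun _ => hδ
  simpa only [Subtype.exists, exists_prop] using this

lemma measure_exists_mem_lt_exponentField_ne_zero (hJ : J.Nonempty) (hδ : 0 < δ) :
    (inverseSquareIntensity.prod P₀) {p | ∃ j ∈ J, δ < exponentField η (t j) p} ≠ 0 := by
  obtain ⟨j, hj⟩ := hJ
  intro h0
  have hsub : {p | δ < exponentField η (t j) p} ⊆ {p | ∃ j ∈ J, δ < exponentField η (t j) p} :=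
    fun p hp => ⟨j, hj, hp⟩
  have h2 := h.measure_lt_exponentField (t j) hδ
  rw [measure_mono_null hsub h0] at h2
  exact (ENNReal.ofReal_pos.2 (one_div_pos.2 hδ)).ne h2

/-- Weak convergence of the rescaled max-stable vector to the exponent measure, on the region where
one of the coordinates in `J` is large. -/
lemma tendsto_mul_setIntegral (hJ : J.Nonempty) (hδ : 0 < δ) (f : (ι → ℝ) →ᵇ ℝ) :
    Tendsto (fun x : ℝ => x * ∫ ω in {ω | ∃ j ∈ J, x * δ < maxStableField U ξ (t j) ω},
        f (fun j => x⁻¹ * maxStableField U ξ (t j) ω) ∂P) atTop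
      (𝓝 (∫ p in {p | ∃ j ∈ J, δ < exponentField η (t j) p},
        f (fun j => exponentField η (t j) p) ∂(inverseSquareIntensity.prod P₀))) := by
  classical
  set m := inverseSquareIntensity.prod P₀ with hm_def
  set X := maxStableField U ξ
  set Z := exponentField η
  set B : ℝ → Set Ω := fun x => {ω | ∃ j ∈ J, x * δ < X (t j) ω} with hB_def
  set A : Set (ℝ × Ω₀) := {p | ∃ j ∈ J, δ < Z (t j) p} with hA_def
  have hA : MeasurableSet A := h.measurableSet_exists_mem_lt_exponentField t
  have hB : ∀ x, MeasurableSet (B x) := fun x => h.measurableSet_exists_mem_lt_maxStableField t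
  have hXm : ∀ x : ℝ, Measurable fun ω j => x⁻¹ * X (t j) ω := fun x =>
    measurable_pi_lambda _ fun j => (h.measurable_maxStableField _).const_mul _
  have hZm : Measurable fun p j => Z (t j) p :=
    measurable_pi_lambda _ fun j => h.measurable_exponentField _
  set ρs : ℝ → Measure (ι → ℝ) := fun x =>
    (ENNReal.ofReal x • P.restrict (B x)).map fun ω j => x⁻¹ * X (t j) ω with hρs
  set ρ : Measure (ι → ℝ) := (m.restrict A).map fun p j => Z (t j) p with hρ
  have hAtop : m A ≠ ∞ := h.measure_exists_mem_lt_exponentField_ne_top t hδ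
  have : IsFiniteMeasure (m.restrict A) := isFiniteMeasure_restrict.2 hAtop
  have : ∀ x, IsFiniteMeasure (ENNReal.ofReal x • P.restrict (B x)) := fun x =>
    Measure.smul_finite _ ENNReal.ofReal_ne_top
  have hρs_apply : ∀ x, 0 < x → ∀ s, MeasurableSet s → (ρs x).real s
      = x * P.real ({ω | (fun j => x⁻¹ * X (t j) ω) ∈ s} ∩ B x) := by
    intro x hx s hs
    rw [hρs, map_measureReal_apply (hXm x) hs, measureReal_ennreal_smul_apply,
      ENNReal.toReal_ofReal hx.le, measureReal_restrict_apply (hXm x hs)]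
    rfl
  have hρ_apply : ∀ s, MeasurableSet s → ρ.real s = m.real ({p | (fun j => Z (t j) p) ∈ s} ∩ A) := by
    intro s hs
    rw [hρ, map_measureReal_apply hZm hs, measureReal_restrict_apply (hZm hs)]
    rfl
  have hρ0 : ρ ≠ 0 := by
    intro h0
    have h1 : ρ Set.univ = 0 := by rw [h0]; rfl
    rw [hρ, Measure.map_apply hZm MeasurableSet.univ, Set.preimage_univ,
      Measure.restrict_apply_univ] at h1
    exact h.measure_exists_mem_lt_exponentField_ne_zero t hJ hδ h1
  have huniv : Tendsto (fun x => (ρs x).real Set.univ) atTop (𝓝 (ρ.real Set.univ)) := by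
    have h1 := h.tendsto_mul_real_exists_lt (fun j : J => t j) (y := fun _ => δ) fun _ => hδ
    simp only [Subtype.exists, exists_prop] at h1
    rw [hρ_apply _ MeasurableSet.univ]
    simp only [Set.mem_univ, Set.ofPred_true, Set.univ_inter]
    refine h1.congr' ?_
    filter_upwards [eventually_gt_atTop 0] with x hx
    rw [hρs_apply x hx _ MeasurableSet.univ]
    simp only [Set.mem_univ, Set.ofPred_true, Set.univ_inter]
    rfl
  have hIic : ∀ y, Tendsto (fun x => (ρs x).real (Set.Iic y)) atTop (𝓝 (ρ.real (Set.Iic y))) := by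
    intro y
    rw [hρ_apply _ measurableSet_Iic]
    by_cases hy : ∀ j, 0 < y j
    -- Lowering the thresholds in `J` to at most `δ` turns the event "all coordinates at most `y`,
    -- some coordinate in `J` above `δ`" into a difference of two exceedance events, for `y'` and
    -- for `y`.
    · set y' : ι → ℝ := fun j => if j ∈ J then min (y j) δ else y j with hy'_def
      have hy' : ∀ j, 0 < y' j := fun j => by
        simp only [hy'_def]
        split_ifs
        · exact lt_min (hy j) hδ
        · exact hy j
      have hy'y : ∀ j, y' j ≤ y j := fun j => by
        simp only [hy'_def]
        split_ifs
        · exact min_le_left _ _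
        · exact le_rfl
      have hequiv : ∀ (x : ℝ) (z : ι → ℝ), 0 < x →
          (((∀ j, z j ≤ x * y j) ∧ ∃ j ∈ J, x * δ < z j)
            ↔ ((∃ j, x * y' j < z j) ∧ ¬ ∃ j, x * y j < z j)) := by
        intro x z hx
        simp only [not_exists, not_lt]
        rw [and_comm]
        refine and_congr_left fun hz => ⟨?_, ?_⟩
        · rintro ⟨j, hj, hlt⟩
          refine ⟨j, lt_of_le_of_lt ?_ hlt⟩
          simp only [hy'_def, if_pos hj]
          gcongr
          exact min_le_right _ _
        · rintro ⟨j, hlt⟩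
          by_cases hj : j ∈ J
          · refine ⟨j, hj, ?_⟩
            simp only [hy'_def, if_pos hj, mul_min_of_nonneg _ _ hx.le, min_lt_iff] at hlt
            exact hlt.resolve_left (not_lt.2 (hz j))
          · simp only [hy'_def, if_neg hj] at hlt
            exact absurd hlt (not_lt.2 (hz j))
      have hlim := (h.tendsto_mul_real_exists_lt t hy').sub (h.tendsto_mul_real_exists_lt t hy)
      have hsetZ : {p | (fun j => Z (t j) p) ∈ Set.Iic y} ∩ A
          = {p | ∃ j, y' j < Z (t j) p} \ {p | ∃ j, y j < Z (t j) p} := by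
        ext p
        have := hequiv 1 (fun j => Z (t j) p) one_pos
        simp only [one_mul] at this
        exact this
      have hsubZ : {p | ∃ j, y j < Z (t j) p} ⊆ {p | ∃ j, y' j < Z (t j) p} :=
        fun p ⟨j, hj⟩ => ⟨j, (hy'y j).trans_lt hj⟩
      rw [hsetZ, measureReal_sdiff hsubZ (h.measurableSet_exists_lt_exponentField t y)
        (h.measure_exists_lt_exponentField_ne_top t hy')]
      refine hlim.congr' ?_
      filter_upwards [eventually_gt_atTop 0] with x hx
      rw [hρs_apply x hx _ measurableSet_Iic]
      have hsetX : {ω | (fun j => x⁻¹ * X (t j) ω) ∈ Set.Iic y} ∩ B x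
          = {ω | ∃ j, x * y' j < X (t j) ω} \ {ω | ∃ j, x * y j < X (t j) ω} := by
        ext ω
        rw [Set.mem_sdiff]
        refine Iff.trans ?_ (hequiv x (fun j => X (t j) ω) hx)
        rw [Set.mem_inter_iff]
        refine and_congr_left fun _ => forall_congr' fun j => ?_
        exact inv_mul_le_iff₀ hx
      have hsubX : {ω | ∃ j, x * y j < X (t j) ω} ⊆ {ω | ∃ j, x * y' j < X (t j) ω} :=
        fun ω ⟨j, hj⟩ => ⟨j, lt_of_le_of_lt (by gcongr; exact hy'y j) hj⟩
      rw [hsetX, measureReal_sdiff hsubX ?_, mul_sub]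
      simp only [Set.ofPred_exists]
      exact MeasurableSet.iUnion fun j =>
        measurableSet_lt measurable_const (h.measurable_maxStableField _)
    -- If some `y j ≤ 0`, both sides vanish, because `X` and `Z` are almost surely positive.
    · obtain ⟨j, hj⟩ := not_forall.1 hy
      have hZ0 : m.real ({p | (fun j => Z (t j) p) ∈ Set.Iic y} ∩ A) = 0 := by
        rw [measureReal_def, measure_eq_zero_iff_ae_notMem.2, ENNReal.toReal_zero]
        filter_upwards [h.ae_exponentField_pos] with p hp hmem
        exact hj ((hp (t j)).trans_le (hmem.1 j))
      rw [hZ0]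
      refine tendsto_const_nhds.congr' ?_
      filter_upwards [eventually_gt_atTop 0] with x hx
      rw [hρs_apply x hx _ measurableSet_Iic, measureReal_def, measure_eq_zero_iff_ae_notMem.2,
        ENNReal.toReal_zero, mul_zero]
      filter_upwards [h.ae_maxStableField_pos (t j)] with ω hω hmem
      exact hj ((mul_pos (inv_pos.2 hx) hω).trans_le (hmem.1 j))
  have key := tendsto_integral_of_tendsto_Iic hρ0 huniv hIic f
  rw [hρ, integral_map hZm.aemeasurable f.continuous.aestronglyMeasurable] at key
  refine key.congr' ?_
  filter_upwards [eventually_gt_atTop 0] with x hx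
  rw [hρs, integral_map (hXm x).aemeasurable f.continuous.aestronglyMeasurable,
    integral_smul_measure, ENNReal.toReal_ofReal hx.le, smul_eq_mul]

end IsSpectralRepresentation

/-! ### The punctured space `[-∞, ∞]^ι \ {0}` -/

lemma measurableSet_ne_zero_extended {ι : Type*} [Countable ι] :
    MeasurableSet {z : ι → EReal | z ≠ 0} :=
  (MeasurableSet.singleton (0 : ι → EReal)).compl

lemma measurableEmbedding_puncturedExtended_val {ι : Type*} [Countable ι] :
    MeasurableEmbedding (Subtype.val : PuncturedExtended ι → ι → EReal) :=
  MeasurableEmbedding.subtype_coe measurableSet_ne_zero_extended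

lemma isOpen_ne_zero_extended {ι : Type*} : IsOpen {z : ι → EReal | z ≠ 0} :=
  isClosed_singleton.isOpen_compl

instance {ι : Type*} [Countable ι] : SecondCountableTopology (PuncturedExtended ι) :=
  Topology.IsInducing.subtypeVal.secondCountableTopology

instance {ι : Type*} [Countable ι] :
    TopologicalSpace.PseudoMetrizableSpace (PuncturedExtended ι) :=
  Topology.IsInducing.subtypeVal.pseudoMetrizableSpace

instance {ι : Type*} : LocallyCompactSpace (PuncturedExtended ι) :=
  isOpen_ne_zero_extended.locallyCompactSpace

lemma integral_comap_puncturedExtended_val {ι : Type*} [Countable ι]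
    (κ : Measure (ι → EReal)) (f : PuncturedExtended ι → ℝ) :
    ∫ z, f z ∂(κ.comap Subtype.val) = ∫ z, Function.extend Subtype.val f 0 z ∂κ := by
  rw [← setIntegral_eq_integral_of_forall_compl_eq_zero (s := {z : ι → EReal | z ≠ 0}),
    ← integral_subtype_comap measurableSet_ne_zero_extended]
  · refine integral_congr_ae (ae_of_all _ fun z => ?_)
    exact (Subtype.val_injective.extend_apply f 0 z).symm
  · intro z hz
    rw [Function.extend_apply' _ _ _ fun ⟨w, hw⟩ => hz (by rw [← hw]; exact w.2), Pi.zero_apply]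

/-- The restriction to `ℝ^ι` of a continuous function with compact support in
`[-∞, ∞]^ι \ {0}`. -/
lemma exists_boundedContinuousFunction_extend_eq {ι : Type*} [Fintype ι]
    {f : PuncturedExtended ι → ℝ} (hf : Continuous f) (hc : HasCompactSupport f) :
    ∃ (g : (ι → ℝ) →ᵇ ℝ) (δ : ℝ), 0 < δ ∧
      (∀ z : ι → ℝ, Function.extend Subtype.val f 0 (fun i => (z i : EReal)) = g z) ∧
      ∀ z : ι → ℝ, (∀ i, |z i| ≤ δ) → g z = 0 := by
  -- Compact support in the open punctured space keeps `f` away from the origin, so extension by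
  -- zero is continuous there.
  have hcont : Continuous (Function.extend Subtype.val f 0) :=
    HasCompactSupport.continuous_extend_zero isOpen_ne_zero_extended hf hc
  have hcoe : Continuous fun (z : ι → ℝ) i => (z i : EReal) :=
    continuous_pi fun i => continuous_coe_real_ereal.comp (continuous_apply i)
  set g : (ι → ℝ) →ᵇ ℝ := (BoundedContinuousFunction.mkOfCompact
    ⟨Function.extend Subtype.val f 0, hcont⟩).compContinuous ⟨_, hcoe⟩ with hg
  set K : Set (ι → EReal) := Subtype.val '' tsupport f with hK_def
  have hK : IsClosed K := (hc.isCompact.image continuous_subtype_val).isClosed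
  have hK0 : (fun i => ((0 : ι → ℝ) i : EReal)) ∉ K := by
    rintro ⟨w, -, hw⟩
    refine w.2 (hw.trans ?_)
    ext i
    simp
  -- The support is closed in the whole product and misses the origin, so a ball around the origin
  -- avoids it; half its radius serves as `δ`.
  obtain ⟨ε, hε, hball⟩ := Metric.isOpen_iff.1 (hK.preimage hcoe).isOpen_compl 0 hK0
  refine ⟨g, ε / 2, half_pos hε, fun z => rfl, fun z hz => ?_⟩
  have hzK : (fun i => (z i : EReal)) ∉ K := by
    refine hball ?_
    rw [Metric.mem_ball, dist_zero_right]
    exact lt_of_le_of_lt ((pi_norm_le_iff_of_nonneg (half_pos hε).le).2 hz) (half_lt_self hε)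
  change Function.extend Subtype.val f 0 (fun i => (z i : EReal)) = 0
  by_cases hz0 : (fun i => (z i : EReal)) = 0
  · rw [Function.extend_apply' _ _ _ fun ⟨w, hw⟩ => w.2 (hw.trans hz0), Pi.zero_apply]
  · rw [show (fun i => (z i : EReal)) = ((⟨_, hz0⟩ : PuncturedExtended ι) : ι → EReal) from rfl,
      Subtype.val_injective.extend_apply]
    by_contra hne
    exact hzK ⟨⟨_, hz0⟩, subset_tsupport f hne, rfl⟩

lemma isRegularlyVaryingFunction_inv : IsRegularlyVaryingFunction (fun x => x⁻¹) (-1) := by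
  refine ⟨measurable_inv, fun x hx => inv_pos.2 hx, fun u hu => ?_⟩
  refine tendsto_const_nhds.congr' ?_
  filter_upwards [eventually_gt_atTop 0] with x hx
  rw [Real.rpow_neg_one]
  field_simp

/-! ### Regular variation of max-stable vectors -/

/-- The exponent measure of a max-stable vector, on `[-∞, ∞]^ι \ {0}`. -/
noncomputable def exponentMeasure {T Ω₀ : Type*} [MeasurableSpace Ω₀] (P₀ : Measure Ω₀)
    (η : T → Ω₀ → ℝ) {ι : Type*} (t : ι → T) : Measure (PuncturedExtended ι) :=
  ((inverseSquareIntensity.prod P₀).map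
    fun p i => (exponentField η (t i) p : EReal)).comap Subtype.val

namespace IsSpectralRepresentation

set_option linter.unusedSectionVars false

variable {T Ω₀ Ω : Type*} [MeasurableSpace Ω₀] [MeasurableSpace Ω]
  {P₀ : Measure Ω₀} [IsProbabilityMeasure P₀] {P : Measure Ω} [IsProbabilityMeasure P]
  {η : T → Ω₀ → ℝ} {U : ℕ → Ω → ℝ} {ξ : ℕ → T → Ω → ℝ}
  (h : IsSpectralRepresentation P₀ P η U ξ)
  {ι : Type*} [Fintype ι] (t : ι → T)

include h

lemma measurable_coe_exponentField :
    Measurable fun p i => (exponentField η (t i) p : EReal) :=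
  measurable_pi_lambda _ fun _ => (h.measurable_exponentField _).coe_real_ereal

lemma exponentMeasure_preimage {s : Set (ι → EReal)} (hs : MeasurableSet s) (hs0 : 0 ∉ s) :
    exponentMeasure P₀ η t (Subtype.val ⁻¹' s)
      = (inverseSquareIntensity.prod P₀) {p | (fun i => (exponentField η (t i) p : EReal)) ∈ s} := by
  rw [exponentMeasure, measurableEmbedding_puncturedExtended_val.comap_apply,
    Set.image_preimage_eq_of_subset (fun z hz => ⟨⟨z, fun h0 => hs0 (h0 ▸ hz)⟩, rfl⟩),
    Measure.map_apply (h.measurable_coe_exponentField t) hs]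
  rfl

lemma exponentMeasure_lt {c : ℝ} (hc : 0 < c) (j : ι) :
    exponentMeasure P₀ η t (Subtype.val ⁻¹' {z | (c : EReal) < z j}) = ENNReal.ofReal (1 / c) := by
  rw [h.exponentMeasure_preimage t (measurableSet_lt measurable_const (measurable_pi_apply j)),
    ← h.measure_lt_exponentField (t j) hc]
  · simp only [Set.mem_ofPred_eq, EReal.coe_lt_coe_iff]
  · simp only [Set.mem_ofPred_eq, Pi.zero_apply, not_lt]
    exact_mod_cast hc.le

/-- A point of the punctured space has a nonzero coordinate `j`. If it is negative, `{z j < 0}` is a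
null neighbourhood; if positive, `{c < z j}` for a smaller `c > 0` has mass `1 / c`. -/
lemma isLocallyFiniteMeasure_exponentMeasure :
    IsLocallyFiniteMeasure (exponentMeasure P₀ η t) := by
  refine ⟨fun w => ?_⟩
  obtain ⟨j, hj⟩ := Function.ne_iff.1 w.2
  have hcont : Continuous fun z : PuncturedExtended ι => z.1 j :=
    (continuous_apply j).comp continuous_subtype_val
  rcases lt_or_gt_of_ne hj with hlt | hgt
  · refine ⟨Subtype.val ⁻¹' {z | z j < 0}, (isOpen_lt hcont continuous_const).mem_nhds hlt, ?_⟩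
    rw [h.exponentMeasure_preimage t (measurableSet_lt (measurable_pi_apply j) measurable_const)
      (by simp), measure_eq_zero_iff_ae_notMem.2]
    · exact ENNReal.zero_lt_top
    · filter_upwards [h.ae_exponentField_pos] with p hp hmem
      have hneg : (exponentField η (t j) p : EReal) < 0 := hmem
      exact absurd (hp (t j)) (not_lt.2 (by exact_mod_cast hneg.le))
  · obtain ⟨c, hc0, hcw⟩ := EReal.lt_iff_exists_real_btwn.1 hgt
    refine ⟨Subtype.val ⁻¹' {z | (c : EReal) < z j},
      (isOpen_lt continuous_const hcont).mem_nhds hcw, ?_⟩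
    rw [Pi.zero_apply] at hc0
    rw [h.exponentMeasure_lt t (by exact_mod_cast hc0)]
    exact ENNReal.ofReal_lt_top

/-- Test functions vanish near the origin, so their integrals are unchanged by restriction to the
region where some coordinate exceeds `δ`, and `tendsto_mul_setIntegral` applies with `J = univ`. -/
lemma isRegularlyVaryingVector [Nonempty ι] :
    IsRegularlyVaryingVector P (fun i => maxStableField U ξ (t i)) 1 := by
  refine ⟨one_pos, fun x => x⁻¹, exponentMeasure P₀ η t, isRegularlyVaryingFunction_inv, ?_, ?_,
    ?_, ?_⟩
  · have := h.isLocallyFiniteMeasure_exponentMeasure t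
    -- Regularity comes from local finiteness on a σ-compact pseudometrizable space.
    have : SigmaCompactSpace (PuncturedExtended ι) := inferInstance
    infer_instance
  · intro h0
    have h1 := h.exponentMeasure_lt t one_pos (Classical.arbitrary ι)
    rw [h0] at h1
    simp at h1
  · have hs : MeasurableSet {z : ι → EReal | ∃ i, z i = ⊤ ∨ z i = ⊥} := by
      simp only [Set.ofPred_exists]
      refine MeasurableSet.iUnion fun i => MeasurableSet.union ?_ ?_ <;>
      exact measurableSet_eq_fun (measurable_pi_apply i) measurable_const
    have h1 := h.exponentMeasure_preimage t hs (by simp)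
    refine h1.trans ?_
    simp
  · intro f hf hc
    obtain ⟨g, δ, hδ, hg, hg0⟩ := exists_boundedContinuousFunction_extend_eq hf hc
    have hmeas : AEStronglyMeasurable (Function.extend Subtype.val f 0)
        ((inverseSquareIntensity.prod P₀).map
          fun p i => (exponentField η (t i) p : EReal)) :=
      (HasCompactSupport.continuous_extend_zero isOpen_ne_zero_extended hf hc).aestronglyMeasurable
    have hmeasX : ∀ x : ℝ, Measurable
        fun ω i => ((x⁻¹ * maxStableField U ξ (t i) ω : ℝ) : EReal) := fun x =>
      measurable_pi_lambda _ fun _ =>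
        ((h.measurable_maxStableField _).const_mul _).coe_real_ereal
    have key := h.tendsto_mul_setIntegral t Set.univ_nonempty hδ g
    rw [setIntegral_eq_integral_of_ae_compl_eq_zero] at key
    · rw [exponentMeasure, integral_comap_puncturedExtended_val,
        integral_map (h.measurable_coe_exponentField t).aemeasurable hmeas]
      simp_rw [hg]
      refine key.congr' ?_
      filter_upwards [eventually_gt_atTop 0] with x hx
      have hI : ∫ z, f z ∂(scaledLaw P (fun i => maxStableField U ξ (t i)) x)
          = ∫ ω, g (fun i => x⁻¹ * maxStableField U ξ (t i) ω) ∂P := by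
        rw [scaledLaw, integral_comap_puncturedExtended_val]
        refine (integral_map (hmeasX x).aemeasurable (HasCompactSupport.continuous_extend_zero
          isOpen_ne_zero_extended hf hc).aestronglyMeasurable).trans ?_
        exact integral_congr_ae (ae_of_all _ fun ω => hg _)
      rw [hI, setIntegral_eq_integral_of_ae_compl_eq_zero, div_inv_eq_mul, mul_comm]
      filter_upwards [ae_all_iff.2 fun i => h.ae_maxStableField_pos (t i)] with ω hω hmem
      refine hg0 _ fun i => ?_
      rw [abs_of_pos (mul_pos (inv_pos.2 hx) (hω i)), inv_mul_le_iff₀ hx]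
      by_contra hlt
      exact hmem ⟨i, Set.mem_univ i, not_le.1 hlt⟩
    · filter_upwards [h.ae_exponentField_pos] with p hp hmem
      refine hg0 _ fun i => ?_
      rw [abs_of_pos (hp _)]
      by_contra hlt
      exact hmem ⟨i, Set.mem_univ i, not_le.1 hlt⟩

end IsSpectralRepresentation

/-! ### The tail field of a max-stable field -/

lemma ciSup_option_of_finite {ι : Type*} [Finite ι] [Nonempty ι] (a : Option ι → ℝ) :
    ⨆ o, a o = max (⨆ i, a (some i)) (a none) := by
  refine le_antisymm (ciSup_le fun o => ?_) (max_le (ciSup_le fun i => ?_) ?_)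
  · rcases o with _ | i
    · exact le_max_right _ _
    · exact le_max_of_le_left (le_ciSup (f := fun i => a (some i)) (Set.finite_range _).bddAbove i)
  · exact le_ciSup (Set.finite_range a).bddAbove (some i)
  · exact le_ciSup (Set.finite_range a).bddAbove none

/-- The law of the tail field of the max-stable field with spectral field `η`. -/
noncomputable def tailLaw {T Ω₀ : Type*} [Zero T] [MeasurableSpace Ω₀] (P₀ : Measure Ω₀)
    (η : T → Ω₀ → ℝ) : Measure (T → ℝ) :=
  ((inverseSquareIntensity.prod P₀).restrict {p | 1 < exponentField η 0 p}).map
    fun p t => exponentField η t p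

namespace IsSpectralRepresentation

set_option linter.unusedSectionVars false

variable {T Ω₀ Ω : Type*} [MeasurableSpace Ω₀] [MeasurableSpace Ω]
  {P₀ : Measure Ω₀} [IsProbabilityMeasure P₀] {P : Measure Ω} [IsProbabilityMeasure P]
  {η : T → Ω₀ → ℝ} {U : ℕ → Ω → ℝ} {ξ : ℕ → T → Ω → ℝ}
  (h : IsSpectralRepresentation P₀ P η U ξ)

include h

lemma integrable_ciSup {ι : Type*} [Finite ι] (t : ι → T) {y : ι → ℝ} (hy : ∀ j, 0 < y j) :
    Integrable (fun ω => ⨆ j, 1 / y j * η (t j) ω) P₀ := by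
  refine ⟨(Measurable.iSup fun j => (h.measurable_spectral _).const_mul _).aestronglyMeasurable, ?_⟩
  rw [hasFiniteIntegral_iff_ofReal (ae_of_all _ fun ω => Real.iSup_nonneg fun j =>
    mul_nonneg (one_div_pos.2 (hy j)).le (h.spectral_pos _ _).le),
    ← h.measure_exists_lt_exponentField t hy]
  exact (h.measure_exists_lt_exponentField_ne_top t hy).lt_top

lemma integral_ciSup {ι : Type*} [Finite ι] (t : ι → T) {y : ι → ℝ} (hy : ∀ j, 0 < y j) :
    ∫ ω, (⨆ j, 1 / y j * η (t j) ω) ∂P₀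
      = (inverseSquareIntensity.prod P₀).real {p | ∃ j, y j < exponentField η (t j) p} := by
  rw [measureReal_def, h.measure_exists_lt_exponentField t hy]
  exact integral_eq_lintegral_of_nonneg_ae (ae_of_all _ fun ω => Real.iSup_nonneg fun j =>
    mul_nonneg (one_div_pos.2 (hy j)).le (h.spectral_pos _ _).le)
    (h.integrable_ciSup t hy).aestronglyMeasurable

variable [Zero T]

/-- The mass of `{1 < Z 0}` is the mean of `η 0`, hence `1`; no normalization is needed. -/
lemma isProbabilityMeasure_restrict :
    IsProbabilityMeasure
      ((inverseSquareIntensity.prod P₀).restrict {p | 1 < exponentField η 0 p}) := by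
  refine ⟨?_⟩
  rw [Measure.restrict_apply_univ, h.measure_lt_exponentField 0 one_pos]
  simp

lemma measurable_exponentField_pi : Measurable fun p t => exponentField η t p :=
  measurable_pi_lambda _ h.measurable_exponentField

lemma integral_tailLaw {n : ℕ} (t : Fin n → T) (f : (Fin n → ℝ) →ᵇ ℝ) :
    ∫ z, f (fun i => z (t i)) ∂(tailLaw P₀ η) = ∫ p in {p | 1 < exponentField η 0 p},
      f (fun i => exponentField η (t i) p) ∂(inverseSquareIntensity.prod P₀) := by
  have hfm : Measurable fun (z : T → ℝ) i => z (t i) :=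
    measurable_pi_lambda _ fun i => measurable_pi_apply (t i)
  exact integral_map h.measurable_exponentField_pi.aemeasurable
    (f.continuous.measurable.comp hfm).aestronglyMeasurable

/-- The conditional expectation is a quotient. Multiplying both parts by `x`, the numerator
converges by `tendsto_mul_setIntegral` and the denominator tends to `1`. -/
lemma isTailField_tailLaw :
    IsTailField P (maxStableField U ξ) (tailLaw P₀ η) fun t z => z t := by
  have := h.isProbabilityMeasure_restrict
  refine ⟨Measure.isProbabilityMeasure_map h.measurable_exponentField_pi.aemeasurable,
    fun t => measurable_pi_apply t, fun n t f => ?_⟩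
  rw [h.integral_tailLaw t f]
  -- The origin is adjoined as the coordinate `none`, the only one required to be large; `f` ignores
  -- it.
  set t' : Option (Fin n) → T := fun o => o.elim 0 t with ht'
  have key := h.tendsto_mul_setIntegral t' (J := {none}) (Set.singleton_nonempty _) one_pos
    (f.compContinuous ⟨fun (z : Option (Fin n) → ℝ) i => z (some i), by fun_prop⟩)
  simp only [Set.mem_singleton_iff, exists_eq_left, mul_one] at key
  change Tendsto (fun x : ℝ => x * ∫ ω in {ω | x < maxStableField U ξ 0 ω},
      f (fun i => x⁻¹ * maxStableField U ξ (t i) ω) ∂P) atTop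
    (𝓝 (∫ p in {p | 1 < exponentField η 0 p},
      f (fun i => exponentField η (t i) p) ∂(inverseSquareIntensity.prod P₀))) at key
  have hmass := h.tendsto_mul_real_exists_lt (fun _ : Unit => (0 : T)) (y := fun _ => 1)
    fun _ => one_pos
  simp only [exists_const, mul_one] at hmass
  rw [measureReal_def, h.measure_lt_exponentField 0 one_pos, div_one, ENNReal.ofReal_one,
    ENNReal.toReal_one] at hmass
  have hlim := key.div hmass one_ne_zero
  rw [div_one] at hlim
  refine hlim.congr' ?_
  filter_upwards [eventually_gt_atTop 0] with x hx
  have hset : {ω | x < |maxStableField U ξ 0 ω|} =ᵐ[P] {ω | x < maxStableField U ξ 0 ω} := by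
    filter_upwards [h.ae_maxStableField_pos 0] with ω hω
    refine propext ?_
    change x < |maxStableField U ξ 0 ω| ↔ x < maxStableField U ξ 0 ω
    rw [abs_of_pos hω]
  rw [Pi.div_apply, ProbabilityTheory.cond, measure_congr hset, Measure.restrict_congr_set hset,
    integral_smul_measure, ENNReal.toReal_inv, smul_eq_mul, ← measureReal_def,
    mul_div_mul_left _ _ hx.ne', div_eq_inv_mul]

/-- Uniqueness of weak limits forces every tail field to have the finite-dimensional laws of
`tailLaw`. Equality of laws gives the formula at every `y`, not merely at continuity points. -/
lemma real_tailField_le {Ω' : Type*} [MeasurableSpace Ω'] {Q : Measure Ω'} {Y : T → Ω' → ℝ}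
    (hY : IsTailField P (maxStableField U ξ) Q Y) {n : ℕ} (t : Fin n → T) (y : Fin n → ℝ) :
    Q.real {ω | ∀ i, Y (t i) ω ≤ y i} = (inverseSquareIntensity.prod P₀).real
      ({p | 1 < exponentField η 0 p} ∩ {p | ∀ i, exponentField η (t i) p ≤ y i}) := by
  have hQ := hY.1
  have := h.isProbabilityMeasure_restrict
  have hYm : Measurable fun ω i => Y (t i) ω := measurable_pi_lambda _ fun i => hY.2.1 (t i)
  have hZm : Measurable fun p i => exponentField η (t i) p :=
    measurable_pi_lambda _ fun i => h.measurable_exponentField (t i)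
  have hlaw : Q.map (fun ω i => Y (t i) ω)
      = ((inverseSquareIntensity.prod P₀).restrict {p | 1 < exponentField η 0 p}).map
        fun p i => exponentField η (t i) p := by
    have := Measure.isProbabilityMeasure_map (μ := Q) hYm.aemeasurable
    have := Measure.isProbabilityMeasure_map
      (μ := (inverseSquareIntensity.prod P₀).restrict {p | 1 < exponentField η 0 p})
      hZm.aemeasurable
    refine ext_of_forall_integral_eq_of_IsFiniteMeasure fun f => ?_
    have h1 := tendsto_nhds_unique (hY.2.2 n t f) (h.isTailField_tailLaw.2.2 n t f)
    rw [h.integral_tailLaw t f] at h1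
    rw [integral_map hYm.aemeasurable f.continuous.aestronglyMeasurable,
      integral_map hZm.aemeasurable f.continuous.aestronglyMeasurable]
    exact h1
  have h2 := congrArg (fun κ : Measure (Fin n → ℝ) => κ.real (Set.Iic y)) hlaw
  rw [map_measureReal_apply hYm measurableSet_Iic, map_measureReal_apply hZm measurableSet_Iic,
    measureReal_restrict_apply (hZm measurableSet_Iic), Set.inter_comm] at h2
  exact h2

/-- The finite-dimensional distribution functions of the tail field. -/
lemma real_tailField_le_eq_sub {Ω' : Type*} [MeasurableSpace Ω'] {Q : Measure Ω'} {Y : T → Ω' → ℝ}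
    (hY : IsTailField P (maxStableField U ξ) Q Y) {n : ℕ} (hn : 0 < n) (t : Fin n → T)
    {y : Fin n → ℝ} (hy : ∀ i, 0 < y i) :
    Integrable (fun ω => max (⨆ i, 1 / y i * η (t i) ω) (η 0 ω)) P₀ ∧
    Integrable (fun ω => ⨆ i, 1 / y i * η (t i) ω) P₀ ∧
    Q.real {ω | ∀ i, Y (t i) ω ≤ y i} =
      (∫ ω, max (⨆ i, 1 / y i * η (t i) ω) (η 0 ω) ∂P₀)
        - ∫ ω, (⨆ i, 1 / y i * η (t i) ω) ∂P₀ := by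
  have : Nonempty (Fin n) := ⟨⟨0, hn⟩⟩
  set t' : Option (Fin n) → T := fun o => o.elim 0 t with ht'
  set y' : Option (Fin n) → ℝ := fun o => o.elim 1 y with hy'_def
  have hy' : ∀ o, 0 < y' o := by
    rintro (_ | i)
    · exact one_pos
    · exact hy i
  have hmax : (fun ω => max (⨆ i, 1 / y i * η (t i) ω) (η 0 ω))
      = fun ω => ⨆ o, 1 / y' o * η (t' o) ω := by
    ext ω
    rw [ciSup_option_of_finite]
    simp [ht', hy'_def]
  rw [hmax]
  refine ⟨h.integrable_ciSup t' hy', h.integrable_ciSup t hy, ?_⟩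
  have hsub : {p | ∃ i, y i < exponentField η (t i) p}
      ⊆ {p | ∃ o, y' o < exponentField η (t' o) p} := fun p ⟨i, hi⟩ => ⟨some i, hi⟩
  rw [h.real_tailField_le hY t y, h.integral_ciSup t' hy', h.integral_ciSup t hy,
    ← measureReal_sdiff hsub (h.measurableSet_exists_lt_exponentField t y)
      (h.measure_exists_lt_exponentField_ne_top t' hy')]
  congr 1
  ext p
  simp only [Set.mem_inter_iff, Set.mem_ofPred_eq, Set.mem_sdiff, not_exists, not_lt]
  -- With no exceedance at the `t i`, an exceedance in the enlarged family can only be the one at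
  -- the origin, where the threshold is `1`.
  refine and_congr_left fun hp => ⟨fun h1 => ⟨none, h1⟩, ?_⟩
  rintro ⟨_ | i, hi⟩
  · exact hi
  · exact absurd hi (not_lt.2 (hp i))

end IsSpectralRepresentation

/-! ### Exponential tilting of Gaussian vectors -/

lemma gaussianReal_real_Iic (c : ℝ) {v : ℝ≥0} (hv : 0 < v) (a : ℝ) :
    (gaussianReal c v).real (Set.Iic a) = stdNormalCDF ((a - c) / √v) := by
  have hs : 0 < √(v : ℝ) := Real.sqrt_pos.2 hv
  have hmap : gaussianReal c v = (gaussianReal 0 1).map fun x => c + √(v : ℝ) * x := by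
    have h1 : (fun x : ℝ => c + √(v : ℝ) * x) = (fun x => c + x) ∘ fun x => √(v : ℝ) * x := rfl
    rw [h1, ← Measure.map_map (by fun_prop) (by fun_prop), gaussianReal_map_const_mul,
      gaussianReal_map_const_add]
    congr 1
    · ring
    · ext
      simp
  rw [hmap, map_measureReal_apply (by fun_prop) measurableSet_Iic, stdNormalCDF, cdf_eq_real]
  congr 1
  ext x
  simp only [Set.mem_preimage, Set.mem_Iic]
  rw [le_div_iff₀ hs]
  constructor <;> intro h <;> linarith

section Gaussian

variable {Ω : Type*} [MeasurableSpace Ω] {P : Measure Ω}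

lemma integrable_exp_of_hasGaussianLaw {A : Ω → ℝ} (hA : HasGaussianLaw A P) :
    Integrable (fun ω => Real.exp (A ω)) P := by
  have h1 := integrable_exp_mul_gaussianReal (μ := P[A]) (v := Var[A; P].toNNReal) 1
  rw [← hA.map_eq_gaussianReal, integrable_map_measure (by fun_prop) hA.aemeasurable] at h1
  simpa [Function.comp_def] using h1

lemma integral_exp_of_hasGaussianLaw {A : Ω → ℝ} (hA : HasGaussianLaw A P)
    (hA0 : ∫ ω, A ω ∂P = 0) : ∫ ω, Real.exp (A ω) ∂P = Real.exp (Var[A; P] / 2) := by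
  have h1 := mgf_gaussianReal hA.map_eq_gaussianReal 1
  simpa [mgf, hA0, variance_nonneg] using h1

/-- The tilted moment generating function at `s` is `𝔼 exp (A + s D) / 𝔼 exp A = exp (s cov(D, A) +
s² Var D / 2)`: the tilt shifts the mean by the covariance and keeps the variance. -/
lemma map_tilted_eq_gaussianReal {A D : Ω → ℝ} (hAD : HasGaussianLaw (fun ω => (A ω, D ω)) P)
    (hA0 : ∫ ω, A ω ∂P = 0) (hD0 : ∫ ω, D ω ∂P = 0) :
    (P.tilted A).map D = gaussianReal (cov[D, A; P]) Var[D; P].toNNReal := by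
  have := hAD.isProbabilityMeasure
  have hA : HasGaussianLaw A P := hAD.map (ContinuousLinearMap.fst ℝ ℝ ℝ)
  have hD : HasGaussianLaw D P := hAD.map (ContinuousLinearMap.snd ℝ ℝ ℝ)
  have hint := integrable_exp_of_hasGaussianLaw hA
  have := isProbabilityMeasure_tilted hint
  have hDm : AEMeasurable D (P.tilted A) :=
    hD.aemeasurable.mono_ac (tilted_absolutelyContinuous P A)
  have hmgf : mgf D (P.tilted A) = mgf id (gaussianReal (cov[D, A; P]) Var[D; P].toNNReal) := by
    ext s
    rw [mgf_id_gaussianReal, mgf, integral_exp_tilted]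
    have hAsD : HasGaussianLaw (A + fun ω => s * D ω) P :=
      hAD.map (ContinuousLinearMap.fst ℝ ℝ ℝ + s • ContinuousLinearMap.snd ℝ ℝ ℝ)
    have hmean : ∫ ω, (A + fun ω => s * D ω) ω ∂P = 0 := by
      simp only [Pi.add_apply]
      rw [integral_add hA.integrable (hD.integrable.const_mul s), integral_const_mul, hA0, hD0]
      ring
    rw [integral_exp_of_hasGaussianLaw hAsD hmean, integral_exp_of_hasGaussianLaw hA hA0,
      ← Real.exp_sub, variance_add hA.memLp_two (hD.memLp_two.const_mul s),
      variance_const_mul, covariance_const_mul_right, covariance_comm A D,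
      Real.coe_toNNReal _ (variance_nonneg D P)]
    congr 1
    ring
  -- The moment generating function is finite on all of `ℝ`, so its analytic extension is determined
  -- on `ℂ`, and with it the law.
  have hcomplex := eqOn_complexMGF_of_mgf hmgf.symm
  rw [integrableExpSet_id_gaussianReal] at hcomplex
  have := Measure.ext_of_complexMGF_eq hDm aemeasurable_id (funext fun z =>
    (hcomplex (by simp)).symm : complexMGF D (P.tilted A) = complexMGF id _)
  rwa [Measure.map_id] at this

/-- As `exp (Var A / 2) = 𝔼 exp A`, the integrand is the tilting density and the integral is a
tilted probability. -/
lemma setIntegral_exp_sub_half_variance {A D : Ω → ℝ}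
    (hAD : HasGaussianLaw (fun ω => (A ω, D ω)) P)
    (hA0 : ∫ ω, A ω ∂P = 0) (hD0 : ∫ ω, D ω ∂P = 0) (hDm : Measurable D)
    (hD : 0 < Var[D; P]) (a : ℝ) :
    ∫ ω in {ω | D ω ≤ a}, Real.exp (A ω - Var[A; P] / 2) ∂P
      = stdNormalCDF ((a - cov[D, A; P]) / √(Var[D; P])) := by
  have hA : HasGaussianLaw A P := hAD.map (ContinuousLinearMap.fst ℝ ℝ ℝ)
  have hS : MeasurableSet {ω | D ω ≤ a} := measurableSet_le hDm measurable_const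
  have h1 := gaussianReal_real_Iic (cov[D, A; P]) (Real.toNNReal_pos.2 hD) a
  rw [← map_tilted_eq_gaussianReal hAD hA0 hD0, map_measureReal_apply hDm measurableSet_Iic,
    Real.coe_toNNReal _ hD.le] at h1
  rw [← h1]
  have h2 := setIntegral_tilted' (μ := P) A (fun _ => (1 : ℝ)) hS
  rw [setIntegral_const, smul_eq_mul, mul_one, integral_exp_of_hasGaussianLaw hA hA0] at h2
  refine Eq.trans ?_ h2.symm
  simp_rw [smul_eq_mul, mul_one, Real.exp_sub]

end Gaussian

/-! ### One-dimensional margins of the tail field in the Gaussian case -/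

section GaussianField

set_option linter.unusedSectionVars false

variable {k : ℕ} {Ω₀ : Type*} [MeasurableSpace Ω₀] {P₀ : Measure Ω₀} [IsProbabilityMeasure P₀]
  {W : (Fin k → ℝ) → Ω₀ → ℝ}

lemma measurable_expGaussian (hW : IsStationaryIncrementGaussianField P₀ W) (t : Fin k → ℝ) :
    Measurable (expGaussian P₀ W t) :=
  ((hW.measurable t).sub_const _).exp

lemma integrable_expGaussian (hW : IsStationaryIncrementGaussianField P₀ W) (t : Fin k → ℝ) :
    Integrable (expGaussian P₀ W t) P₀ := by
  unfold expGaussian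
  simp_rw [Real.exp_sub]
  exact (integrable_exp_of_hasGaussianLaw (hW.gaussian.hasGaussianLaw_eval t)).div_const _

lemma integral_expGaussian (hW : IsStationaryIncrementGaussianField P₀ W) (t : Fin k → ℝ) :
    ∫ ω, expGaussian P₀ W t ω ∂P₀ = 1 := by
  unfold expGaussian
  simp_rw [Real.exp_sub]
  rw [integral_div, integral_exp_of_hasGaussianLaw (hW.gaussian.hasGaussianLaw_eval t)
    (hW.mean_zero t), div_self (Real.exp_pos _).ne']

lemma hasGaussianLaw_prodMk_increment (hW : IsStationaryIncrementGaussianField P₀ W)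
    (s t : Fin k → ℝ) : HasGaussianLaw (fun ω => (W s ω, W t ω - W 0 ω)) P₀ := by
  classical
  set I : Finset (Fin k → ℝ) := {s, t, 0}
  exact (hW.gaussian.hasGaussianLaw I).map
    ((ContinuousLinearMap.proj (R := ℝ) (φ := fun _ : I => ℝ) ⟨s, by simp [I]⟩).prod
      (ContinuousLinearMap.proj (R := ℝ) (φ := fun _ : I => ℝ) ⟨t, by simp [I]⟩
        - ContinuousLinearMap.proj (R := ℝ) (φ := fun _ : I => ℝ) ⟨0, by simp [I]⟩))

lemma memLp_two_field (hW : IsStationaryIncrementGaussianField P₀ W) (t : Fin k → ℝ) :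
    MemLp (W t) 2 P₀ := (hW.gaussian.hasGaussianLaw_eval t).memLp_two

lemma integral_increment (hW : IsStationaryIncrementGaussianField P₀ W) (t : Fin k → ℝ) :
    ∫ ω, (W t ω - W 0 ω) ∂P₀ = 0 := by
  rw [integral_sub ((memLp_two_field hW t).integrable one_le_two)
    ((memLp_two_field hW 0).integrable one_le_two), hW.mean_zero, hW.mean_zero, sub_zero]

lemma variance_increment (hW : IsStationaryIncrementGaussianField P₀ W) (t : Fin k → ℝ) :
    Var[fun ω => W t ω - W 0 ω; P₀] = variogram P₀ W t :=
  variance_of_integral_eq_zero ((hW.measurable t).sub (hW.measurable 0)).aemeasurable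
    (integral_increment hW t)

lemma variogram_eq (hW : IsStationaryIncrementGaussianField P₀ W) (t : Fin k → ℝ) :
    variogram P₀ W t = Var[W t; P₀] - 2 * cov[W t, W 0; P₀] + Var[W 0; P₀] := by
  rw [← variance_increment hW]
  exact variance_sub (memLp_two_field hW t) (memLp_two_field hW 0)

/-- The integrand `max (η t / y, η 0) - η t / y` lives on `{η t / y ≤ η 0}`, a half-line event for
the increment `D`. Its two terms are then tilted probabilities, one for `W 0` and one for `W t`. -/
lemma integral_max_expGaussian_sub (hW : IsStationaryIncrementGaussianField P₀ W)
    (t : Fin k → ℝ) {y : ℝ} (hy : 0 < y) (hγ : 0 < variogram P₀ W t) :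
    ∫ ω, max (1 / y * expGaussian P₀ W t ω) (expGaussian P₀ W 0 ω) ∂P₀
      - ∫ ω, 1 / y * expGaussian P₀ W t ω ∂P₀
    = stdNormalCDF ((2 * Real.log y + variogram P₀ W t) / (2 * √(variogram P₀ W t)))
      - 1 / y * stdNormalCDF ((2 * Real.log y - variogram P₀ W t)
        / (2 * √(variogram P₀ W t))) := by
  -- The threshold comes from taking logarithms in `η t ≤ y * η 0`.
  set a : ℝ := Real.log y + (Var[W t; P₀] - Var[W 0; P₀]) / 2 with ha
  set D : Ω₀ → ℝ := fun ω => W t ω - W 0 ω with hD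
  have hDm : Measurable D := (hW.measurable t).sub (hW.measurable 0)
  have hS : MeasurableSet {ω | D ω ≤ a} := measurableSet_le hDm measurable_const
  have hi0 := integrable_expGaussian hW 0
  have hit := (integrable_expGaussian hW t).const_mul (1 / y)
  have hpoint : ∀ ω, max (1 / y * expGaussian P₀ W t ω) (expGaussian P₀ W 0 ω)
      - 1 / y * expGaussian P₀ W t ω = Set.indicator {ω | D ω ≤ a}
        (fun ω => expGaussian P₀ W 0 ω - 1 / y * expGaussian P₀ W t ω) ω := by
    intro ω
    have hiff : D ω ≤ a ↔ 1 / y * expGaussian P₀ W t ω ≤ expGaussian P₀ W 0 ω := by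
      rw [one_div, inv_mul_le_iff₀ hy]
      unfold expGaussian
      nth_rw 1 [← Real.exp_log hy]
      rw [← Real.exp_add, Real.exp_le_exp]
      simp only [hD, ha]
      constructor <;> intro h <;> linarith
    by_cases hω : D ω ≤ a
    · rw [Set.indicator_of_mem (by exact hω), max_eq_right (hiff.1 hω)]
    · rw [Set.indicator_of_notMem (by exact hω), max_eq_left (le_of_not_ge (hω ∘ hiff.2)), sub_self]
  have himax : Integrable
      (fun ω => max (1 / y * expGaussian P₀ W t ω) (expGaussian P₀ W 0 ω)) P₀ := hit.sup hi0
  rw [← integral_sub himax hit]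
  simp_rw [hpoint]
  rw [integral_indicator hS, integral_sub hi0.integrableOn hit.integrableOn, integral_const_mul]
  have hvar : Var[D; P₀] = variogram P₀ W t := variance_increment hW t
  have hsq : 0 < √(variogram P₀ W t) := Real.sqrt_pos.2 hγ
  have hcov : ∀ s, cov[D, W s; P₀] = cov[W t, W s; P₀] - cov[W 0, W s; P₀] := fun s =>
    covariance_fun_sub_left (memLp_two_field hW t) (memLp_two_field hW 0) (memLp_two_field hW s)
  have hform : ∀ s, ∫ ω in {ω | D ω ≤ a}, expGaussian P₀ W s ω ∂P₀
      = stdNormalCDF ((a - cov[D, W s; P₀]) / √(variogram P₀ W t)) := by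
    intro s
    rw [← hvar]
    exact setIntegral_exp_sub_half_variance (hasGaussianLaw_prodMk_increment hW s t)
      (hW.mean_zero s) (integral_increment hW t) hDm (by rwa [hvar]) a
  have hγ' := variogram_eq hW t
  rw [hform, hform, hcov, hcov, covariance_self (hW.measurable 0).aemeasurable,
    covariance_self (hW.measurable t).aemeasurable, covariance_comm (W 0) (W t)]
  -- Both arguments simplify through `γ t = Var (W t) - 2 cov(W t, W 0) + Var (W 0)`.
  congr 2
  · rw [div_eq_div_iff hsq.ne' (by positivity)]
    rw [show 2 * Real.log y + variogram P₀ W t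
      = 2 * (a - (cov[W t, W 0; P₀] - Var[W 0; P₀])) by rw [hγ', ha]; ring]
    ring
  · congr 1
    rw [div_eq_div_iff hsq.ne' (by positivity)]
    rw [show 2 * Real.log y - variogram P₀ W t
      = 2 * (a - (Var[W t; P₀] - cov[W t, W 0; P₀])) by rw [hγ', ha]; ring]
    ring

/-- A vanishing variogram forces `W t = W 0` almost surely, so the two exponentials coincide and
have mean one. -/
lemma integral_max_expGaussian_sub_of_variogram_eq_zero
    (hW : IsStationaryIncrementGaussianField P₀ W) (t : Fin k → ℝ) (y : ℝ)
    (hγ : variogram P₀ W t = 0) :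
    ∫ ω, max (1 / y * expGaussian P₀ W t ω) (expGaussian P₀ W 0 ω) ∂P₀
      - ∫ ω, 1 / y * expGaussian P₀ W t ω ∂P₀ = max 0 (1 - 1 / y) := by
  have hae : W t =ᵐ[P₀] W 0 := by
    have hint : Integrable (fun ω => (W t ω - W 0 ω) ^ 2) P₀ :=
      ((memLp_two_field hW t).sub (memLp_two_field hW 0)).integrable_sq
    have h0 := (integral_eq_zero_iff_of_nonneg (fun ω => sq_nonneg _) hint).1 hγ
    filter_upwards [h0] with ω hω
    exact sub_eq_zero.1 (pow_eq_zero_iff two_ne_zero |>.1 hω)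
  have hexp : ∀ᵐ ω ∂P₀, expGaussian P₀ W t ω = expGaussian P₀ W 0 ω := by
    filter_upwards [hae] with ω hω
    rw [expGaussian, expGaussian, hω, variance_congr hae]
  have h1 : ∫ ω, max (1 / y * expGaussian P₀ W t ω) (expGaussian P₀ W 0 ω) ∂P₀
      = ∫ ω, max (1 / y) 1 * expGaussian P₀ W 0 ω ∂P₀ := by
    refine integral_congr_ae ?_
    filter_upwards [hexp] with ω hω
    rw [hω, max_mul_of_nonneg _ _ (show 0 ≤ expGaussian P₀ W 0 ω from (Real.exp_pos _).le), one_mul]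
  rw [h1, integral_const_mul, integral_const_mul, integral_expGaussian hW,
    integral_expGaussian hW, mul_one, mul_one, max_comm, ← max_sub_sub_right, sub_self, max_comm]

end GaussianField

/-! ### Brown-Resnick fields -/

lemma gridPoint_zero {k : ℕ} : gridPoint (0 : Fin k → ℤ) = 0 := by
  ext j
  simp [gridPoint]

/-- Each mark is a measurable function `φ` of a whole path, so equality in law and independence
carry over from the Gaussian copies. -/
lemma isSpectralRepresentation_brownResnick {k : ℕ} {Ω₀ Ω : Type*} [MeasurableSpace Ω₀]
    [MeasurableSpace Ω] {P₀ : Measure Ω₀} [IsProbabilityMeasure P₀] {P : Measure Ω}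
    {W : (Fin k → ℝ) → Ω₀ → ℝ} (hW : IsStationaryIncrementGaussianField P₀ W)
    {U : ℕ → Ω → ℝ} (hU : IsPoissonPointProcess P U inverseSquareIntensity)
    {Wc : ℕ → (Fin k → ℝ) → Ω → ℝ} (hWc_meas : ∀ i t, Measurable (Wc i t))
    (hWc_copy : ∀ i, IdentDistrib (fun ω t => Wc i t ω) (fun ω t => W t ω) P P₀)
    (hWc_indep : iIndepFun (fun i ω t => Wc i t ω) P)
    (hWU : IndepFun (fun ω i t => Wc i t ω) (fun ω i => U i ω) P) :
    IsSpectralRepresentation P₀ P (fun t : Fin k → ℤ => expGaussian P₀ W (gridPoint t)) U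
      fun i t ω => Real.exp (Wc i (gridPoint t) ω - Var[W (gridPoint t); P₀] / 2) := by
  have hφ : Measurable fun (z : (Fin k → ℝ) → ℝ) (t : Fin k → ℤ) =>
      Real.exp (z (gridPoint t) - Var[W (gridPoint t); P₀] / 2) :=
    measurable_pi_lambda _ fun t => ((measurable_pi_apply _).sub_const _).exp
  exact {
    poisson := hU
    measurable_spectral := fun t => measurable_expGaussian hW _
    spectral_pos := fun t ω => Real.exp_pos _
    lintegral_spectral := fun t => by
      rw [← ofReal_integral_eq_lintegral_ofReal (integrable_expGaussian hW _)
        (ae_of_all _ fun ω => (Real.exp_pos _).le), integral_expGaussian hW, ENNReal.ofReal_one]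
    measurable_mark := fun i t => ((hWc_meas i _).sub_const _).exp
    mark_pos := fun i t ω => Real.exp_pos _
    identDistrib := fun i => (hWc_copy i).comp hφ
    iIndep := hWc_indep.comp _ fun _ => hφ
    indep := hWU.comp (φ := fun (z : ℕ → (Fin k → ℝ) → ℝ) i (t : Fin k → ℤ) =>
        Real.exp (z i (gridPoint t) - Var[W (gridPoint t); P₀] / 2)) (ψ := id)
      (measurable_pi_lambda _ fun i => hφ.comp (measurable_pi_apply i)) measurable_id }

theorem mainTheorem8 {k : ℕ} {Ω₀ Ω : Type*} [MeasurableSpace Ω₀] [MeasurableSpace Ω]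
    (P₀ : Measure Ω₀) [IsProbabilityMeasure P₀] (P : Measure Ω) [IsProbabilityMeasure P]
    -- the Gaussian field
    (W : (Fin k → ℝ) → Ω₀ → ℝ) (hW : IsStationaryIncrementGaussianField P₀ W)
    -- the Poisson point process on `(0, ∞)` with intensity `du / u²`
    (U : ℕ → Ω → ℝ) (hU : IsPoissonPointProcess P U inverseSquareIntensity)
    -- the i.i.d. copies of the Gaussian field, independent of the Poisson points
    (Wc : ℕ → (Fin k → ℝ) → Ω → ℝ) (hWc_meas : ∀ i t, Measurable (Wc i t))
    (hWc_copy : ∀ i, IdentDistrib (fun ω t => Wc i t ω) (fun ω t => W t ω) P P₀)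
    (hWc_indep : iIndepFun (fun i ω t => Wc i t ω) P)
    (hWU : IndepFun (fun ω i t => Wc i t ω) (fun ω i => U i ω) P)
    -- the Brown-Resnick field on the integer grid
    (X : (Fin k → ℤ) → Ω → ℝ)
    (hX : ∀ t ω, X t ω = brownResnickField P₀ W U Wc (gridPoint t) ω) :
    IsJointlyRegularlyVarying P X 1 ∧
    (∃ Q : Measure ((Fin k → ℤ) → ℝ), IsTailField P X Q (fun t z => z t)) ∧
    ∀ {Ω' : Type*} [MeasurableSpace Ω'] (Q : Measure Ω') (Y : (Fin k → ℤ) → Ω' → ℝ),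
      IsTailField P X Q Y →
      (∀ n : ℕ, 0 < n → ∀ (t : Fin n → (Fin k → ℤ)) (y : Fin n → ℝ), (∀ i, 0 < y i) →
        Integrable (fun ω => max (⨆ i, 1 / y i * expGaussian P₀ W (gridPoint (t i)) ω)
          (expGaussian P₀ W 0 ω)) P₀ ∧
        Integrable (fun ω => ⨆ i, 1 / y i * expGaussian P₀ W (gridPoint (t i)) ω) P₀ ∧
        Q.real {ω | ∀ i, Y (t i) ω ≤ y i} =
          (∫ ω, max (⨆ i, 1 / y i * expGaussian P₀ W (gridPoint (t i)) ω)
            (expGaussian P₀ W 0 ω) ∂P₀)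
          - ∫ ω, (⨆ i, 1 / y i * expGaussian P₀ W (gridPoint (t i)) ω) ∂P₀) ∧
      (∀ (t : Fin k → ℤ) (y : ℝ), 0 < y → 0 < variogram P₀ W (gridPoint t) →
        Q.real {ω | Y t ω ≤ y} =
          stdNormalCDF ((2 * Real.log y + variogram P₀ W (gridPoint t))
            / (2 * √(variogram P₀ W (gridPoint t))))
          - 1 / y * stdNormalCDF ((2 * Real.log y - variogram P₀ W (gridPoint t))
            / (2 * √(variogram P₀ W (gridPoint t))))) ∧
      -- the limiting form of the previous formula when the variogram vanishes
      (∀ (t : Fin k → ℤ) (y : ℝ), 0 < y → variogram P₀ W (gridPoint t) = 0 →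
        Q.real {ω | Y t ω ≤ y} = max 0 (1 - 1 / y)) := by
  have h := isSpectralRepresentation_brownResnick hW hU hWc_meas hWc_copy hWc_indep hWU
  obtain rfl : X = maxStableField U fun i t ω =>
      Real.exp (Wc i (gridPoint t) ω - Var[W (gridPoint t); P₀] / 2) := by
    ext t ω
    exact hX t ω
  refine ⟨fun n hn t => ?_, ⟨_, h.isTailField_tailLaw⟩, fun Q Y hY => ?_⟩
  · have : Nonempty (Fin n) := ⟨⟨0, hn⟩⟩
    exact h.isRegularlyVaryingVector t
  · have hdf : ∀ (t : Fin k → ℤ) {y : ℝ}, 0 < y → Q.real {ω | Y t ω ≤ y}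
        = ∫ ω, max (1 / y * expGaussian P₀ W (gridPoint t) ω) (expGaussian P₀ W 0 ω) ∂P₀
          - ∫ ω, 1 / y * expGaussian P₀ W (gridPoint t) ω ∂P₀ := by
      intro t y hy
      have h1 := (h.real_tailField_le_eq_sub hY one_pos (fun _ => t) (y := fun _ => y)
        fun _ => hy).2.2
      simpa only [forall_const, ciSup_const, gridPoint_zero] using h1
    refine ⟨fun n hn t y hy => ?_, fun t y hy hγ => ?_, fun t y hy hγ => ?_⟩
    · have h1 := h.real_tailField_le_eq_sub hY hn t hy
      rwa [gridPoint_zero] at h1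
    · rw [hdf t hy, integral_max_expGaussian_sub hW _ hy hγ]
    · rw [hdf t hy, integral_max_expGaussian_sub_of_variogram_eq_zero hW _ y hγ]
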